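/- Let $A$ be a unital C$^*$-algebra, $B \subset A$ a C$^*$-subalgebra containing $1_A$, and $E : A \to B$ a conditional expectation. Let $L^2(A,E)$ be the Hilbert $B$-module obtained from $A$ by separation and completion with respect to $\langle a, b\rangle = E(a^*b)$, with left action $\pi_E$ of $A$ by left multiplication, and regard $X = L^2(A,E)\otimes_B A$ (interior tensor product, $A$ being the Hilbert $A$-module with $\langle x,y\rangle = x^*y$ and left multiplication by $B$) as a C$^*$-correspondence over $A$ with left action $\pi_X = \pi_E\otimes 1$. The triple $(A,B,E)$ is called nuclear if $X$ has the universal factorization property: for every C$^*$-algebra $C$ and every nondegenerate $*$-representation $\sigma : A\otimes_{\max} C\to \mathbb B(H)$, with associated commuting representations $\sigma_A$ of $A$ and $\sigma_C$ of $C$ satisfying $\sigma(a\otimes c)=\sigma_A(a)\sigma_C(c)$, the kernel of the representation $$\phi_X^H : A\otimes_{\max} C\to \mathbb B(X\otimes_{\sigma_A} H),\qquad a\otimes c\mapsto \pi_X(a)\otimes\sigma_C(c),$$ is contained in the kernel of $\sigma$ (equivalently, $\sigma$ factors through the image of $\phi_X^H$). Then $(A,B,E)$ is nuclear if and only if for every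 finite subset $\mathfrak F\subset A$ and every $\varepsilon>0$ there exist $n,m\in\mathbb N$ and completely positive maps $\varphi_k : A\to \mathbb M_n(B)$ and $\psi_k:\mathbb M_n(B)\to A$, $1\le k\le m$, such that $\|a-\sum_{k=1}^m\psi_k\circ\varphi_k(a)\|<\varepsilon$ for all $a\in\mathfrak F$, and such that for each $k$ there are $x_1,\dots,x_n,y_1,\dots,y_n\in A$ (depending on $k$) with $$\varphi_k(a)=\bigl[E(x_i^*ax_j)\bigr]_{i,j=1}^n\quad(a\in A),\qquad \psi_k\bigl([b_{ij}]_{i,j=1}^n\bigr)=\sum_{i,j=1}^n y_i^*b_{ij}y_j\quad([b_{ij}]\in\mathbb M_n(B)).$$ -/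

import Mathlib

open scoped ComplexOrder TensorProduct ENNReal CStarAlgebra
open MulOpposite (op)

universe u

namespace RelNuc

universe v w

set_option linter.unusedSectionVars false

/-! ### Hilbert C⋆-modules -/

/-- A (right) Hilbert C⋆-module over a unital C⋆-algebra `B`, with inner product conjugate linear
in the first variable. The right action of `b` on `x` is `op b • x`. Definiteness of the inner
product is contained in `norm_eq`. -/
structure HilbertModule (B : Type v) [CStarAlgebra B] [PartialOrder B] where
  carrier : Type w
  [normedAddCommGroup : NormedAddCommGroup carrier]
  [normedSpace : NormedSpace ℂ carrier]
  [completeSpace : CompleteSpace carrier]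
  [module : Module Bᵐᵒᵖ carrier]
  [isScalarTower : IsScalarTower ℂ Bᵐᵒᵖ carrier]
  [smulCommClass : SMulCommClass ℂ Bᵐᵒᵖ carrier]
  ip : carrier →ₗ⋆[ℂ] carrier →ₗ[ℂ] B
  ip_smul : ∀ (x y : carrier) (b : B), ip x (op b • y) = ip x y * b
  star_ip : ∀ x y : carrier, star (ip x y) = ip y x
  ip_nonneg : ∀ x : carrier, 0 ≤ ip x x
  norm_eq : ∀ x : carrier, ‖x‖ = √‖ip x x‖

attribute [instance] HilbertModule.normedAddCommGroup HilbertModule.normedSpace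
  HilbertModule.completeSpace HilbertModule.module HilbertModule.isScalarTower
  HilbertModule.smulCommClass

/-- An `A`-`B` C⋆-correspondence: a Hilbert `B`-module with a `*`-homomorphism `left` from `A` to
the adjointable operators (`left (star a)` is the adjoint of `left a`). -/
structure Corr (A : Type u) (B : Type v) [CStarAlgebra A] [CStarAlgebra B] [PartialOrder B]
    extends HilbertModule.{v, w} B where
  left : A →ₙₐ[ℂ] (carrier →L[ℂ] carrier)
  left_adj : ∀ (a : A) (x y : carrier), ip (left (star a) x) y = ip x (left a y)

/-! ### Separation and completion of a semi-inner product -/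

/-- A `B`-valued semi-inner product on a complex vector space `V` with a right action of `B`. The
laws of the action are not needed here: they hold in the separated completion because of
`ip_ract`. -/
structure SemiIP (B : Type v) (V : Type w) [CStarAlgebra B] [PartialOrder B] [AddCommGroup V]
    [Module ℂ V] where
  ip : V →ₗ⋆[ℂ] V →ₗ[ℂ] B
  ract : B → V → V
  ip_ract : ∀ (x y : V) (b : B), ip x (ract b y) = ip x y * b
  star_ip : ∀ x y : V, star (ip x y) = ip y x
  nonneg : ∀ x : V, 0 ≤ ip x x

namespace SemiIP

variable {B : Type v} {V : Type w} [CStarAlgebra B] [PartialOrder B] [StarOrderedRing B]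
  [AddCommGroup V] [Module ℂ V] (S : SemiIP B V)

theorem ip_ract_left (x y : V) (b : B) : S.ip (S.ract b x) y = star b * S.ip x y := by
  rw [← S.star_ip, S.ip_ract, star_mul, S.star_ip]

theorem star_mul_le (x y : V) (t : ℝ) (ht : ‖S.ip x x‖ < t) :
    star (S.ip x y) * S.ip x y ≤ t • S.ip y y := by
  have ht0 : 0 < t := (norm_nonneg _).trans_lt ht
  set a := S.ip x y with ha
  have h1 := S.nonneg (S.ract a x - (t : ℂ) • y)
  have h2 : S.ip (S.ract a x - (t : ℂ) • y) (S.ract a x - (t : ℂ) • y)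
      = star a * S.ip x x * a - t • (star a * a) - t • (star a * a) + t • t • S.ip y y := by
    have hyx : S.ip y x = star a := by rw [ha, S.star_ip]
    simp only [map_sub, LinearMap.sub_apply, LinearMap.map_smulₛₗ, LinearMap.smul_apply,
      S.ip_ract, S.ip_ract_left, hyx, ← ha]
    simp only [Complex.conj_ofReal, RingHom.id_apply, Complex.coe_smul, smul_sub]
    abel
  rw [h2] at h1
  have h3 : star a * S.ip x x * a ≤ t • (star a * a) :=
    (CStarAlgebra.star_left_conjugate_le_norm_smul (IsSelfAdjoint.of_nonneg (S.nonneg x))).trans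
      (smul_le_smul_of_nonneg_right ht.le (star_mul_self_nonneg a))
  have h4 : 0 ≤ t • (t • S.ip y y - star a * a) := by
    refine h1.trans ?_
    rw [smul_sub]
    have := sub_le_sub_right (sub_le_sub_right h3 (t • (star a * a))) (t • (star a * a))
    calc _ ≤ t • (star a * a) - t • (star a * a) - t • (star a * a) + t • t • S.ip y y := by
          gcongr
      _ = _ := by abel
  have h5 : 0 ≤ t • S.ip y y - star a * a := by
    have := smul_nonneg (inv_nonneg.2 ht0.le) h4
    rwa [inv_smul_smul₀ ht0.ne'] at this
  exact sub_nonneg.1 h5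

theorem norm_ip_le (x y : V) : ‖S.ip x y‖ ≤ √‖S.ip x x‖ * √‖S.ip y y‖ := by
  rw [← Real.sqrt_mul (norm_nonneg _)]
  refine Real.le_sqrt_of_sq_le ?_
  rw [sq, ← CStarRing.norm_star_mul_self]
  have key : ∀ t : ℝ, ‖S.ip x x‖ < t → ‖star (S.ip x y) * S.ip x y‖ ≤ t * ‖S.ip y y‖ := by
    intro t ht
    have h := CStarAlgebra.norm_le_norm_of_nonneg_of_le (star_mul_self_nonneg _)
      (S.star_mul_le x y t ht)
    rwa [norm_smul, Real.norm_of_nonneg ((norm_nonneg _).trans ht.le)] at h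
  refine ge_of_tendsto (x := nhdsWithin ‖S.ip x x‖ (Set.Ioi ‖S.ip x x‖))
    (f := fun t => t * ‖S.ip y y‖) ?_ (eventually_nhdsWithin_of_forall key)
  exact ((continuous_id.mul continuous_const).tendsto _).mono_left nhdsWithin_le_nhds

/-- The vector space `V`, regarded as a seminormed space through the semi-inner product `S`. -/
@[nolint unusedArguments]
def Space (_ : SemiIP B V) : Type w := V

theorem norm_add_le' (x y : V) :
    √‖S.ip (x + y) (x + y)‖ ≤ √‖S.ip x x‖ + √‖S.ip y y‖ := by
  rw [Real.sqrt_le_left (by positivity)]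
  have h1 := S.norm_ip_le x y
  have h2 := S.norm_ip_le y x
  have hx := Real.sq_sqrt (norm_nonneg (S.ip x x))
  have hy := Real.sq_sqrt (norm_nonneg (S.ip y y))
  have h3 : ‖S.ip (x + y) (x + y)‖
      ≤ ‖S.ip x x‖ + ‖S.ip y x‖ + (‖S.ip x y‖ + ‖S.ip y y‖) := by
    simp only [map_add, LinearMap.add_apply]
    exact (norm_add_le _ _).trans (add_le_add (norm_add_le _ _) (norm_add_le _ _))
  nlinarith

/-- The seminorm `‖⟨x, x⟩‖ ^ (1/2)`. -/
noncomputable def seminorm : Seminorm ℂ V :=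
  Seminorm.of (fun x => √‖S.ip x x‖) S.norm_add_le' (fun z x => by
    simp only [LinearMap.map_smulₛₗ, LinearMap.smul_apply, norm_smul, RingHom.id_apply,
      RCLike.norm_conj]
    rw [← mul_assoc, Real.sqrt_mul (by positivity), Real.sqrt_mul_self (norm_nonneg _)])

noncomputable instance : SeminormedAddCommGroup S.Space :=
  AddGroupSeminorm.toSeminormedAddCommGroup (E := V) S.seminorm.toAddGroupSeminorm

noncomputable instance : NormedSpace ℂ S.Space where
  toModule := (inferInstance : Module ℂ V)
  norm_smul_le z x := (map_smul_eq_mul S.seminorm z x).le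

/-- The separated completion of `V`. -/
abbrev Hat : Type w := UniformSpace.Completion S.Space

/-- The canonical map with dense range into the separated completion. -/
noncomputable def incl : V →ₗ[ℂ] S.Hat :=
  (UniformSpace.Completion.toComplL (𝕜 := ℂ) (E := S.Space)).toLinearMap

theorem denseRange_incl : DenseRange S.incl :=
  UniformSpace.Completion.denseRange_coe (α := S.Space)

theorem norm_incl (x : V) : ‖S.incl x‖ = √‖S.ip x x‖ :=
  UniformSpace.Completion.norm_coe (E := S.Space) x

theorem norm_ip_le_incl (x y : V) : ‖S.ip x y‖ ≤ ‖S.incl x‖ * ‖S.incl y‖ := by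
  rw [norm_incl, norm_incl]; exact S.norm_ip_le x y

theorem incl_eq_zero {z : V} (h : ∀ w, S.ip w z = 0) : S.incl z = 0 := by
  rw [← norm_eq_zero, norm_incl, h]; simp

/-- The vector-valued form `⟨x, ·⟩` on the completion, for `x` in `V`. -/
noncomputable def ipAux : V →ₗ⋆[ℂ] (S.Hat →L[ℂ] B) where
  toFun x := (S.ip x).extendOfNorm S.incl
  map_add' x y := by
    refine LinearMap.extendOfNorm_unique S.denseRange_incl (‖S.incl (x + y)‖)
      (S.norm_ip_le_incl _) _ ?_
    ext z
    simp [LinearMap.extendOfNorm_eq S.denseRange_incl ⟨_, S.norm_ip_le_incl _⟩]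
  map_smul' c x := by
    refine LinearMap.extendOfNorm_unique S.denseRange_incl (‖S.incl (c • x)‖)
      (S.norm_ip_le_incl _) _ ?_
    ext z
    simp [LinearMap.extendOfNorm_eq S.denseRange_incl ⟨_, S.norm_ip_le_incl _⟩]

theorem ipAux_incl (x y : V) : S.ipAux x (S.incl y) = S.ip x y :=
  LinearMap.extendOfNorm_eq S.denseRange_incl ⟨_, S.norm_ip_le_incl _⟩ y

theorem norm_ipAux_le (x : V) : ‖S.ipAux x‖ ≤ 1 * ‖S.incl x‖ := by
  rw [one_mul]
  exact LinearMap.opNorm_extendOfNorm_le S.denseRange_incl (norm_nonneg _) (S.norm_ip_le_incl x)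

/-- The inner product on the completion. -/
noncomputable def ipHat : S.Hat →L⋆[ℂ] (S.Hat →L[ℂ] B) := S.ipAux.extendOfNorm S.incl

theorem ipHat_incl (x y : V) : S.ipHat (S.incl x) (S.incl y) = S.ip x y := by
  rw [ipHat, LinearMap.extendOfNorm_eq S.denseRange_incl ⟨_, S.norm_ipAux_le⟩, ipAux_incl]

theorem continuous_ipHat : Continuous fun p : S.Hat × S.Hat => S.ipHat p.1 p.2 := by
  fun_prop

theorem star_ipHat (x y : S.Hat) : star (S.ipHat x y) = S.ipHat y x := by
  refine S.denseRange_incl.induction_on₂ (p := fun x y => star (S.ipHat x y) = S.ipHat y x)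
    ?_ ?_ x y
  · exact isClosed_eq (continuous_star.comp S.continuous_ipHat)
      (S.continuous_ipHat.comp continuous_swap)
  · intro x y
    rw [ipHat_incl, ipHat_incl, S.star_ip]

theorem ipHat_nonneg (x : S.Hat) : 0 ≤ S.ipHat x x := by
  refine S.denseRange_incl.induction_on (p := fun x => 0 ≤ S.ipHat x x) x ?_ ?_
  · exact CStarAlgebra.isClosed_nonneg.preimage
      (S.continuous_ipHat.comp (continuous_id.prodMk continuous_id))
  · intro x
    rw [ipHat_incl]
    exact S.nonneg x

theorem norm_hat (x : S.Hat) : ‖x‖ = √‖S.ipHat x x‖ := by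
  refine S.denseRange_incl.induction_on (p := fun x => ‖x‖ = √‖S.ipHat x x‖) x ?_ ?_
  · exact isClosed_eq continuous_norm
      (S.continuous_ipHat.comp (continuous_id.prodMk continuous_id)).norm.sqrt
  · intro x
    rw [ipHat_incl, norm_incl]

theorem hat_ext {x y : S.Hat} (h : ∀ w, S.ipHat w x = S.ipHat w y) : x = y := by
  rw [← sub_eq_zero, ← norm_eq_zero, norm_hat, map_sub, h, sub_self]
  simp

/-- The right action of `b`, as a linear map from `V` to the completion. -/
noncomputable def ractAux (b : B) : V →ₗ[ℂ] S.Hat where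
  toFun x := S.incl (S.ract b x)
  map_add' x y := by
    rw [← sub_eq_zero, ← map_add, ← map_sub]
    refine S.incl_eq_zero fun w => ?_
    simp [S.ip_ract, add_mul]
  map_smul' c x := by
    rw [← sub_eq_zero, RingHom.id_apply, ← map_smul, ← map_sub]
    refine S.incl_eq_zero fun w => ?_
    simp [S.ip_ract]

theorem norm_ractAux_le (b : B) (x : V) : ‖S.ractAux b x‖ ≤ ‖b‖ * ‖S.incl x‖ := by
  change ‖S.incl (S.ract b x)‖ ≤ _
  rw [norm_incl, norm_incl, S.ip_ract, S.ip_ract_left]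
  refine Real.sqrt_le_iff.2 ⟨by positivity, ?_⟩
  rw [mul_pow, Real.sq_sqrt (norm_nonneg _)]
  calc ‖star b * S.ip x x * b‖ ≤ ‖star b‖ * ‖S.ip x x‖ * ‖b‖ :=
        (norm_mul_le _ _).trans (by gcongr; exact norm_mul_le _ _)
    _ = _ := by rw [norm_star]; ring

/-- The right action of `b` on the completion. -/
noncomputable def ractHat (b : B) : S.Hat →L[ℂ] S.Hat := (S.ractAux b).extendOfNorm S.incl

theorem ractHat_incl (b : B) (x : V) : S.ractHat b (S.incl x) = S.incl (S.ract b x) :=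
  LinearMap.extendOfNorm_eq S.denseRange_incl ⟨_, S.norm_ractAux_le b⟩ x

theorem ipHat_ractHat (b : B) (x y : S.Hat) :
    S.ipHat x (S.ractHat b y) = S.ipHat x y * b := by
  refine S.denseRange_incl.induction_on₂
    (p := fun x y => S.ipHat x (S.ractHat b y) = S.ipHat x y * b) ?_ ?_ x y
  · exact isClosed_eq (S.continuous_ipHat.comp
      (continuous_fst.prodMk ((S.ractHat b).continuous.comp continuous_snd)))
      (S.continuous_ipHat.mul continuous_const)
  · intro x y
    rw [ractHat_incl, ipHat_incl, ipHat_incl, S.ip_ract]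

/-- The right `B`-module structure of the completion. -/
@[reducible]
noncomputable def moduleHat : Module Bᵐᵒᵖ S.Hat where
  smul b x := S.ractHat b.unop x
  one_smul x := S.hat_ext fun w => by
    change S.ipHat w (S.ractHat 1 x) = _
    rw [ipHat_ractHat, mul_one]
  mul_smul b c x := S.hat_ext fun w => by
    change S.ipHat w (S.ractHat (c.unop * b.unop) x)
      = S.ipHat w (S.ractHat b.unop (S.ractHat c.unop x))
    simp only [ipHat_ractHat, mul_assoc]
  smul_zero b := map_zero (S.ractHat b.unop)
  smul_add b := map_add (S.ractHat b.unop)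
  add_smul b c x := S.hat_ext fun w => by
    change S.ipHat w (S.ractHat (b.unop + c.unop) x)
      = S.ipHat w (S.ractHat b.unop x + S.ractHat c.unop x)
    rw [map_add (S.ipHat w)]
    simp only [ipHat_ractHat, mul_add]
  zero_smul x := S.hat_ext fun w => by
    change S.ipHat w (S.ractHat 0 x) = _
    simp [ipHat_ractHat]

/-- The Hilbert module obtained from a semi-inner product by separation and completion. -/
noncomputable def hilbert : HilbertModule.{v, w} B :=
  letI := S.moduleHat
  { carrier := S.Hat
    isScalarTower := ⟨fun z b x => S.hat_ext fun w => by
      change S.ipHat w (S.ractHat (z • b.unop) x) = S.ipHat w (z • S.ractHat b.unop x)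
      simp [ipHat_ractHat]⟩
    smulCommClass := ⟨fun z b x => (map_smul (S.ractHat b.unop) z x).symm⟩
    ip := LinearMap.mk₂'ₛₗ (starRingEnd ℂ) (RingHom.id ℂ) (fun x y => S.ipHat x y)
      (fun x y z => by simp) (fun c x y => by simp) (fun x y z => by simp)
      (fun c x y => by simp)
    ip_smul := fun x y b => S.ipHat_ractHat b x y
    star_ip := S.star_ipHat
    ip_nonneg := S.ipHat_nonneg
    norm_eq := S.norm_hat }

/-! `*`-representations of a C⋆-algebra on a semi-inner product space extend to the completion. -/

section Rep

variable {D : Type*} [NonUnitalCStarAlgebra D] (ρ : D →ₙₐ[ℂ] Module.End ℂ V)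

theorem ip_rep_le
    (hρ : ∀ (d : D) (x y : V), S.ip (ρ (star d) x) y = S.ip x (ρ d y))
    (d : D) (x : V) :
    S.ip (ρ d x) (ρ d x) ≤ (‖d‖ ^ 2) • S.ip x x := by
  let _ := CStarAlgebra.spectralOrder (Unitization ℂ D)
  let _ := CStarAlgebra.spectralOrderedRing (Unitization ℂ D)
  let r : Unitization ℂ D →ₐ[ℂ] Module.End ℂ V := Unitization.lift ρ
  have hr : ∀ (e : Unitization ℂ D) (x y : V), S.ip (r (star e) x) y = S.ip x (r e y) := by
    intro e x y
    induction e using Unitization.ind with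
    | inl_add_inr z d =>
      simp [r, hρ]
  have hr' : ∀ (e : Unitization ℂ D) (x : V), S.ip (r e x) (r e x) = S.ip x (r (star e * e) x) := by
    intro e x
    rw [map_mul, Module.End.mul_apply, ← hr (star e), star_star]
  have hpos : 0 ≤ algebraMap ℝ (Unitization ℂ D) (‖(d : Unitization ℂ D)‖ ^ 2)
      - star (d : Unitization ℂ D) * d :=
    sub_nonneg.2 CStarAlgebra.star_mul_le_algebraMap_norm_sq
  obtain ⟨c, hc⟩ := CStarAlgebra.nonneg_iff_eq_star_mul_self.1 hpos
  have h := S.nonneg (r c x)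
  rw [hr', ← hc, map_sub, LinearMap.sub_apply, map_sub, ← hr', Algebra.algebraMap_eq_smul_one,
    ← Complex.coe_smul, map_smul, map_one, LinearMap.smul_apply, Module.End.one_apply, map_smul,
    Complex.coe_smul, Unitization.norm_inr] at h
  have hd : r (d : Unitization ℂ D) = ρ d := by simp [r]
  rw [hd] at h
  exact sub_nonneg.1 h

theorem norm_rep_le
    (hρ : ∀ (d : D) (x y : V), S.ip (ρ (star d) x) y = S.ip x (ρ d y))
    (d : D) (x : V) : ‖(S.incl ∘ₗ ρ d) x‖ ≤ ‖d‖ * ‖S.incl x‖ := by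
  rw [LinearMap.comp_apply, norm_incl, norm_incl]
  refine Real.sqrt_le_iff.2 ⟨by positivity, ?_⟩
  rw [mul_pow, Real.sq_sqrt (norm_nonneg _)]
  refine (CStarAlgebra.norm_le_norm_of_nonneg_of_le (S.nonneg _) (S.ip_rep_le ρ hρ d x)).trans ?_
  rw [norm_smul, Real.norm_of_nonneg (by positivity)]

/-- The operator on the completion that extends `ρ d`. -/
noncomputable def repAux (d : D) : S.Hat →L[ℂ] S.Hat := (S.incl ∘ₗ ρ d).extendOfNorm S.incl

theorem repAux_incl
    (hρ : ∀ (d : D) (x y : V), S.ip (ρ (star d) x) y = S.ip x (ρ d y))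
    (d : D) (x : V) : S.repAux ρ d (S.incl x) = S.incl (ρ d x) :=
  LinearMap.extendOfNorm_eq S.denseRange_incl ⟨_, S.norm_rep_le ρ hρ d⟩ x

theorem hat_op_ext {f g : S.Hat →L[ℂ] S.Hat} (h : ∀ x, f (S.incl x) = g (S.incl x)) : f = g :=
  ContinuousLinearMap.ext fun x => S.denseRange_incl.induction_on
    (p := fun x => f x = g x) x (isClosed_eq f.continuous g.continuous) h

variable (hρ : ∀ (d : D) (x y : V), S.ip (ρ (star d) x) y = S.ip x (ρ d y))

/-- The representation on the completion that extends `ρ`. -/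
noncomputable def rep : D →ₙₐ[ℂ] (S.Hat →L[ℂ] S.Hat) where
  toFun d := S.repAux ρ d
  map_smul' z d := S.hat_op_ext fun x => by simp [S.repAux_incl ρ hρ]
  map_zero' := S.hat_op_ext fun x => by simp [S.repAux_incl ρ hρ]
  map_add' d e := S.hat_op_ext fun x => by simp [S.repAux_incl ρ hρ]
  map_mul' d e := S.hat_op_ext fun x => by simp [S.repAux_incl ρ hρ]

theorem rep_incl (d : D) (x : V) : S.rep ρ hρ d (S.incl x) = S.incl (ρ d x) :=
  S.repAux_incl ρ hρ d x

theorem rep_adj (d : D) (x y : S.Hat) :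
    S.ipHat (S.rep ρ hρ (star d) x) y = S.ipHat x (S.rep ρ hρ d y) := by
  refine S.denseRange_incl.induction_on₂
    (p := fun x y => S.ipHat (S.rep ρ hρ (star d) x) y = S.ipHat x (S.rep ρ hρ d y)) ?_ ?_ x y
  · exact isClosed_eq (S.continuous_ipHat.comp
      (((S.rep ρ hρ (star d)).continuous.comp continuous_fst).prodMk continuous_snd))
      (S.continuous_ipHat.comp
        (continuous_fst.prodMk ((S.rep ρ hρ d).continuous.comp continuous_snd)))
  · intro x y
    rw [rep_incl, rep_incl, ipHat_incl, ipHat_incl, hρ]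

end Rep

/-- The correspondence obtained by separation and completion from a semi-inner product space on
which a C⋆-algebra `A` acts. -/
noncomputable def corr {A : Type u} [CStarAlgebra A] (ρ : A →ₙₐ[ℂ] Module.End ℂ V)
    (hρ : ∀ (a : A) (x y : V), S.ip (ρ (star a) x) y = S.ip x (ρ a y)) : Corr.{u, v, w} A B :=
  { S.hilbert with
    left := S.rep ρ hρ
    left_adj := S.rep_adj ρ hρ }

end SemiIP

/-! ### The interior tensor product -/

section Positivity

variable {A : Type u} [CStarAlgebra A] [PartialOrder A] [StarOrderedRing A]

theorem exists_eq_star_mul_self {a : A} (ha : 0 ≤ a) : ∃ b : A, a = star b * b :=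
  CStarAlgebra.nonneg_iff_eq_star_mul_self.1 ha

theorem exists_negPart (M : A) (hM : IsSelfAdjoint M) : ∃ N Q : A, star N = N ∧ N = star Q * Q ∧
    N * M * N = -(N * N * N) ∧ (N = 0 → 0 ≤ M) := by
  have hN0 : 0 ≤ M⁻ := CFC.negPart_nonneg M
  obtain ⟨Q, hQ⟩ := CStarAlgebra.nonneg_iff_eq_star_mul_self.1 hN0
  refine ⟨M⁻, Q, (IsSelfAdjoint.of_nonneg hN0).star_eq, hQ, ?_, fun h => ?_⟩
  · nth_rewrite 2 [← CFC.posPart_sub_negPart M hM]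
    rw [mul_sub, sub_mul, CFC.negPart_mul_posPart]
    simp
  · rw [← CFC.posPart_sub_negPart M hM, h, sub_zero]
    exact CFC.posPart_nonneg M

theorem matrix_nonneg {n : ℕ} (M : CStarMatrix (Fin n) (Fin n) A) (hM : IsSelfAdjoint M)
    (h : ∀ c : Fin n → A, 0 ≤ ∑ i, ∑ j, star (c i) * M i j * c j) : 0 ≤ M := by
  obtain ⟨N, Q, hNs, hQ, hMN, hfin⟩ := exists_negPart M hM
  have hRR : N * N * N = star (Q * N) * (Q * N) := by
    rw [star_mul, hNs, mul_assoc N (star Q), ← mul_assoc (star Q), ← hQ, ← mul_assoc]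
  have hR : Q * N = 0 := by
    have hdiag : ∀ k, ∑ i, star ((Q * N) i k) * (Q * N) i k ≤ 0 := by
      intro k
      have h1 := h fun i => N i k
      have h2 : ∑ i, ∑ j, star (N i k) * M i j * N j k = (N * M * N) k k := by
        rw [mul_assoc]
        simp only [CStarMatrix.mul_apply, Finset.mul_sum]
        refine Finset.sum_congr rfl fun i _ => Finset.sum_congr rfl fun j _ => ?_
        have : star (N i k) = N k i := by
          conv_rhs => rw [← hNs]
          rfl
        rw [this, mul_assoc]
      rw [h2, hMN, hRR] at h1
      have h3 : (star (Q * N) * (Q * N)) k k = ∑ i, star ((Q * N) i k) * (Q * N) i k := by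
        rw [CStarMatrix.mul_apply]; rfl
      rw [← h3]
      exact neg_nonneg.1 h1
    ext i k
    have h4 := (Finset.sum_eq_zero_iff_of_nonneg
      (fun i _ => star_mul_self_nonneg ((Q * N) i k))).1
      (le_antisymm (hdiag k) (Finset.sum_nonneg fun i _ => star_mul_self_nonneg _)) i
      (Finset.mem_univ i)
    exact CStarRing.star_mul_self_eq_zero_iff _ |>.1 h4
  have hNN : star N * N = 0 := by
    rw [hNs]
    nth_rewrite 1 [hQ]
    rw [mul_assoc, hR, mul_zero]
  exact hfin (CStarRing.star_mul_self_eq_zero_iff _ |>.1 hNN)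

end Positivity

namespace Corr

section Tensor

variable {A : Type*} {B : Type*} {C : Type*} [CStarAlgebra A] [CStarAlgebra B] [PartialOrder B]
  [StarOrderedRing B] [CStarAlgebra C] [PartialOrder C] [StarOrderedRing C]
  (X : Corr A B) (Y : Corr B C)

theorem gram_nonneg (X : HilbertModule B) {n : ℕ} (x : Fin n → X.carrier) :
    0 ≤ (CStarMatrix.ofMatrix (fun i j => X.ip (x i) (x j)) : CStarMatrix (Fin n) (Fin n) B) := by
  refine matrix_nonneg _ ?_ ?_
  · ext i j
    exact X.star_ip (x j) (x i)
  · intro c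
    have h := X.ip_nonneg (∑ i, op (c i) • x i)
    have hl : ∀ (b : B) (x y : X.carrier), X.ip (op b • x) y = star b * X.ip x y := by
      intro b x y
      rw [← X.star_ip, X.ip_smul, star_mul, X.star_ip]
    simp only [map_sum, LinearMap.sum_apply, X.ip_smul, hl] at h
    rw [Finset.sum_comm]
    exact h

/-- The sesquilinear form `⟨x ⊗ y, x' ⊗ y'⟩ = ⟨y, ⟨x, x'⟩ y'⟩` on the algebraic tensor product. -/
noncomputable def tensorIP :
    (X.carrier ⊗[ℂ] Y.carrier) →ₗ⋆[ℂ] (X.carrier ⊗[ℂ] Y.carrier) →ₗ[ℂ] C :=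
  TensorProduct.lift <| LinearMap.mk₂'ₛₗ (starRingEnd ℂ) (starRingEnd ℂ)
    (fun x y => TensorProduct.lift <| LinearMap.mk₂ ℂ (fun x' y' => Y.ip y (Y.left (X.ip x x') y'))
      (by simp) (by simp) (by simp) (by simp))
    (fun x₁ x₂ y => by ext; simp)
    (fun c x y => by ext; simp)
    (fun x y₁ y₂ => by ext; simp)
    (fun c x y => by ext; simp)

theorem tensorIP_tmul (x x' : X.carrier) (y y' : Y.carrier) :
    X.tensorIP Y (x ⊗ₜ y) (x' ⊗ₜ y') = Y.ip y (Y.left (X.ip x x') y') := rfl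

theorem tensorIP_nonneg (z : X.carrier ⊗[ℂ] Y.carrier) : 0 ≤ X.tensorIP Y z z := by
  obtain ⟨n, x, y, rfl⟩ : ∃ (n : ℕ) (x : Fin n → X.carrier) (y : Fin n → Y.carrier),
      z = ∑ i, x i ⊗ₜ y i := by
    induction z using TensorProduct.induction_on with
    | zero => exact ⟨0, Fin.elim0, Fin.elim0, by simp⟩
    | tmul x y => exact ⟨1, fun _ => x, fun _ => y, by simp⟩
    | add z w hz hw =>
      obtain ⟨n, x, y, rfl⟩ := hz
      obtain ⟨m, x', y', rfl⟩ := hw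
      exact ⟨n + m, Fin.append x x', Fin.append y y', by simp [Fin.sum_univ_add]⟩
  obtain ⟨b, hb⟩ := exists_eq_star_mul_self (gram_nonneg X.toHilbertModule x)
  have hb' : ∀ i j, X.ip (x i) (x j) = ∑ k, star (b k i) * b k j := fun i j =>
    congrFun (congrFun hb i) j
  have key : X.tensorIP Y (∑ i, x i ⊗ₜ y i) (∑ i, x i ⊗ₜ y i)
      = ∑ k, Y.ip (∑ i, Y.left (b k i) (y i)) (∑ j, Y.left (b k j) (y j)) := by
    simp only [map_sum, LinearMap.sum_apply, tensorIP_tmul, hb', map_mul]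
    have e : ∀ i j : Fin n,
        Y.ip (y i) ((∑ k, Y.left (star (b k i)) * Y.left (b k j)) (y j))
          = ∑ k, Y.ip (Y.left (b k i) (y i)) (Y.left (b k j) (y j)) := by
      intro i j
      have : (∑ k, Y.left (star (b k i)) * Y.left (b k j)) (y j)
          = ∑ k, Y.left (star (b k i)) (Y.left (b k j) (y j)) := by simp
      rw [this, map_sum]
      refine Finset.sum_congr rfl fun k _ => ?_
      rw [← Y.left_adj, star_star]
    simp only [e]
    rw [Finset.sum_congr rfl fun i _ => Finset.sum_comm, Finset.sum_comm]
  rw [key]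
  exact Finset.sum_nonneg fun k _ => Y.ip_nonneg _

/-- The semi-inner product on the algebraic tensor product, with the right action on `Y`. -/
noncomputable def tensorSemi : SemiIP C (X.carrier ⊗[ℂ] Y.carrier) where
  ip := X.tensorIP Y
  ract c := LinearMap.lTensor X.carrier
    { toFun := fun y => op c • y
      map_add' := smul_add _
      map_smul' := fun z y => (smul_comm z (op c) y).symm }
  ip_ract z w c := by
    induction z using TensorProduct.induction_on with
    | zero => simp
    | add z z' hz hz' => rw [map_add, LinearMap.add_apply, LinearMap.add_apply, hz, hz', add_mul]
    | tmul x y =>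
      induction w using TensorProduct.induction_on with
      | zero => simp
      | add w w' hw hw' => rw [map_add, map_add, hw, hw', map_add, add_mul]
      | tmul x' y' =>
        rw [LinearMap.lTensor_tmul, tensorIP_tmul, tensorIP_tmul]
        change Y.ip y (Y.left (X.ip x x') (op c • y')) = _
        rw [← Y.left_adj, Y.ip_smul, Y.left_adj]
  star_ip z w := by
    induction z using TensorProduct.induction_on with
    | zero => simp
    | add z z' hz hz' =>
      rw [map_add, LinearMap.add_apply, star_add, hz, hz', map_add]
    | tmul x y =>
      induction w using TensorProduct.induction_on with
      | zero => simp
      | add w w' hw hw' => rw [map_add, star_add, hw, hw', map_add, LinearMap.add_apply]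
      | tmul x' y' =>
        rw [tensorIP_tmul, tensorIP_tmul, Y.star_ip, ← X.star_ip x x', ← Y.left_adj, star_star]
  nonneg := X.tensorIP_nonneg Y

/-- The action `π_X ⊗ 1` on the algebraic tensor product. -/
noncomputable def leftAct : A →ₙₐ[ℂ] Module.End ℂ (X.carrier ⊗[ℂ] Y.carrier) where
  toFun a := LinearMap.rTensor Y.carrier (X.left a).toLinearMap
  map_smul' z a := by ext; simp [TensorProduct.smul_tmul']
  map_zero' := by ext; simp
  map_add' a b := by ext; simp
  map_mul' a b := by ext; simp

theorem leftAct_adj (a : A) (z w : X.carrier ⊗[ℂ] Y.carrier) :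
    (X.tensorSemi Y).ip (X.leftAct Y (star a) z) w
      = (X.tensorSemi Y).ip z (X.leftAct Y a w) := by
  change X.tensorIP Y (LinearMap.rTensor Y.carrier (X.left (star a)).toLinearMap z) w
    = X.tensorIP Y z (LinearMap.rTensor Y.carrier (X.left a).toLinearMap w)
  induction z using TensorProduct.induction_on with
  | zero => simp
  | add z z' hz hz' => simp only [map_add, LinearMap.add_apply, hz, hz']
  | tmul x y =>
    induction w using TensorProduct.induction_on with
    | zero => simp
    | add w w' hw hw' => simp only [map_add, hw, hw']
    | tmul x' y' =>
      rw [LinearMap.rTensor_tmul, LinearMap.rTensor_tmul, tensorIP_tmul, tensorIP_tmul]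
      exact congrArg (fun b => Y.ip y (Y.left b y')) (X.left_adj a x x')

/-- The interior tensor product `X ⊗_B Y` of correspondences, with left action `π_X ⊗ 1`. -/
noncomputable def tensor : Corr A C := (X.tensorSemi Y).corr (X.leftAct Y) (X.leftAct_adj Y)

variable {D : Type*} [NonUnitalCStarAlgebra D] (τ : D →ₙₐ[ℂ] (Y.carrier →L[ℂ] Y.carrier))

/-- The action `1 ⊗ τ` on the algebraic tensor product. -/
noncomputable def rightAct : D →ₙₐ[ℂ] Module.End ℂ (X.carrier ⊗[ℂ] Y.carrier) where
  toFun d := LinearMap.lTensor X.carrier (τ d).toLinearMap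
  map_smul' z c := by ext; simp
  map_zero' := by ext; simp
  map_add' c d := by ext; simp
  map_mul' c d := by ext; simp

theorem rightAct_adj
    (hτ : ∀ (d : D) (x y : Y.carrier), Y.ip (τ (star d) x) y = Y.ip x (τ d y))
    (hc : ∀ (b : B) (d : D) (y : Y.carrier), Y.left b (τ d y) = τ d (Y.left b y))
    (d : D) (z w : X.carrier ⊗[ℂ] Y.carrier) :
    (X.tensorSemi Y).ip (X.rightAct Y τ (star d) z) w
      = (X.tensorSemi Y).ip z (X.rightAct Y τ d w) := by
  change X.tensorIP Y (LinearMap.lTensor X.carrier (τ (star d)).toLinearMap z) w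
    = X.tensorIP Y z (LinearMap.lTensor X.carrier (τ d).toLinearMap w)
  induction z using TensorProduct.induction_on with
  | zero => simp
  | add z z' hz hz' => simp only [map_add, LinearMap.add_apply, hz, hz']
  | tmul x y =>
    induction w using TensorProduct.induction_on with
    | zero => simp
    | add w w' hw hw' => simp only [map_add, hw, hw']
    | tmul x' y' =>
      rw [LinearMap.lTensor_tmul, LinearMap.lTensor_tmul, tensorIP_tmul, tensorIP_tmul]
      change Y.ip (τ (star d) y) _ = Y.ip y (Y.left _ (τ d y'))
      rw [hτ, hc]

variable (hτ : ∀ (d : D) (x y : Y.carrier), Y.ip (τ (star d) x) y = Y.ip x (τ d y))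
  (hc : ∀ (b : B) (d : D) (y : Y.carrier), Y.left b (τ d y) = τ d (Y.left b y))

/-- For a `*`-homomorphism `τ` from `D` to the adjointable operators on `Y` that commute with the
left action, the `*`-homomorphism `1 ⊗ τ` from `D` to the adjointable operators on `X ⊗_B Y`. -/
noncomputable def tensorRight : D →ₙₐ[ℂ] ((X.tensor Y).carrier →L[ℂ] (X.tensor Y).carrier) :=
  (X.tensorSemi Y).rep (X.rightAct Y τ) (X.rightAct_adj Y τ hτ hc)

theorem tensorRight_adj (d : D) (x y : (X.tensor Y).carrier) :
    (X.tensor Y).ip (X.tensorRight Y τ hτ hc (star d) x) y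
      = (X.tensor Y).ip x (X.tensorRight Y τ hτ hc d y) :=
  (X.tensorSemi Y).rep_adj (X.rightAct Y τ) (X.rightAct_adj Y τ hτ hc) d x y

theorem commute_tensorRight (a : A) (d : D) :
    Commute ((X.tensor Y).left a) (X.tensorRight Y τ hτ hc d) := by
  refine (X.tensorSemi Y).hat_op_ext fun z => ?_
  change (X.tensorSemi Y).rep _ (X.leftAct_adj Y) a
      ((X.tensorSemi Y).rep _ (X.rightAct_adj Y τ hτ hc) d ((X.tensorSemi Y).incl z))
    = (X.tensorSemi Y).rep _ (X.rightAct_adj Y τ hτ hc) d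
      ((X.tensorSemi Y).rep _ (X.leftAct_adj Y) a ((X.tensorSemi Y).incl z))
  rw [SemiIP.rep_incl, SemiIP.rep_incl, SemiIP.rep_incl, SemiIP.rep_incl]
  refine congrArg _ ?_
  change LinearMap.rTensor Y.carrier (X.left a).toLinearMap
      (LinearMap.lTensor X.carrier (τ d).toLinearMap z)
    = LinearMap.lTensor X.carrier (τ d).toLinearMap
      (LinearMap.rTensor Y.carrier (X.left a).toLinearMap z)
  rw [← LinearMap.comp_apply, ← LinearMap.comp_apply, LinearMap.rTensor_comp_lTensor,
    LinearMap.lTensor_comp_rTensor]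

end Tensor

end Corr

/-! ### Hilbert spaces -/

/-- A Hilbert module over `ℂ` is a Hilbert space. -/
noncomputable instance (X : HilbertModule.{0, w} ℂ) : InnerProductSpace ℂ X.carrier where
  inner x y := X.ip x y
  norm_sq_eq_re_inner x := by
    rw [X.norm_eq, Real.sq_sqrt (norm_nonneg _)]
    have h := X.ip_nonneg x
    exact (Complex.re_eq_norm.2 h).symm
  conj_inner_symm x y := X.star_ip y x
  add_left x y z := by simp
  smul_left x y c := by simp

section Reps

variable {A : Type u} [CStarAlgebra A] {H : Type w} [NormedAddCommGroup H] [InnerProductSpace ℂ H]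
  [CompleteSpace H]

/-- A `*`-representation on a Hilbert space, regarded as an `A`-`ℂ` correspondence. -/
noncomputable def Corr.ofRep (σ : A →⋆ₙₐ[ℂ] (H →L[ℂ] H)) : Corr.{u, 0, w} A ℂ :=
  letI : Module ℂᵐᵒᵖ H := Module.compHom H (RingEquiv.toOpposite ℂ).symm.toRingHom
  { carrier := H
    isScalarTower := ⟨fun z b x => mul_smul z b.unop x⟩
    smulCommClass := ⟨fun z b x => smul_comm z b.unop x⟩
    ip := innerₛₗ ℂ
    ip_smul := fun x y b => by
      change inner ℂ x (b • y) = inner ℂ x y * b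
      rw [inner_smul_right, mul_comm]
    star_ip := fun x y => inner_conj_symm y x
    ip_nonneg := fun x => by
      change 0 ≤ inner ℂ x x
      rw [inner_self_eq_norm_sq_to_K]
      exact Complex.zero_le_real.2 (sq_nonneg ‖x‖) |>.trans_eq (by simp)
    norm_eq := fun x => by
      change ‖x‖ = √‖inner ℂ x x‖
      rw [inner_self_eq_norm_sq_to_K, norm_pow, RCLike.norm_ofReal, abs_norm, Real.sqrt_sq (norm_nonneg x)]
    left := σ.toNonUnitalAlgHom
    left_adj := fun a x y => by
      change inner ℂ (σ (star a) x) y = inner ℂ x (σ a y)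
      rw [map_star, ContinuousLinearMap.star_eq_adjoint, ContinuousLinearMap.adjoint_inner_left] }

end Reps

/-! ### The maximal tensor product and its representations -/

/-- A pair of `*`-representations of `A` and `C` with commuting ranges on a Hilbert space: the
same thing as a `*`-representation of the algebraic tensor product of `A` and `C`, given
by `a ⊗ c ↦ σA a * σC c`. -/
structure CommPair (A C : Type u) [CStarAlgebra A] [NonUnitalCStarAlgebra C] where
  H : Type u
  [normedAddCommGroup : NormedAddCommGroup H]
  [innerProductSpace : InnerProductSpace ℂ H]
  [completeSpace : CompleteSpace H]
  σA : A →⋆ₙₐ[ℂ] (H →L[ℂ] H)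
  σC : C →⋆ₙₐ[ℂ] (H →L[ℂ] H)
  commute : ∀ a c, Commute (σA a) (σC c)

attribute [instance] CommPair.normedAddCommGroup CommPair.innerProductSpace CommPair.completeSpace

section Max

variable (A C : Type u) [CStarAlgebra A] [NonUnitalCStarAlgebra C]

/-- The product of all the algebras `B(H)`, over all the commuting pairs of representations. -/
abbrev UnivProd : Type (u + 1) := lp (fun p : CommPair.{u} A C => p.H →L[ℂ] p.H) ∞

variable {A C}

/-- The elementary tensor `a ⊗ c`. -/
noncomputable def pureTensor (a : A) (c : C) : UnivProd A C :=
  ⟨fun p => p.σA a * p.σC c, memℓp_infty ⟨‖a‖ * ‖c‖, by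
    rintro _ ⟨p, rfl⟩
    exact (norm_mul_le _ _).trans (mul_le_mul (NonUnitalStarAlgHom.norm_apply_le _ _)
      (NonUnitalStarAlgHom.norm_apply_le _ _) (norm_nonneg _) (norm_nonneg _))⟩⟩

variable (A C)

/-- The maximal tensor product: the completion of the algebraic tensor product for the norm
`sup ‖∑ σA (a i) * σC (c i)‖` over all commuting pairs of representations, realized as the closed
`*`-subalgebra that the elementary tensors generate in the product of all the `B(H)`. -/
noncomputable def MaxTensor : NonUnitalStarSubalgebra ℂ (UnivProd A C) :=
  (NonUnitalStarAlgebra.adjoin ℂ (Set.range fun q : A × C => pureTensor q.1 q.2)).topologicalClosure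

variable {A C}

/-- The representation of the maximal tensor product with `a ⊗ c ↦ σA a * σC c`. -/
noncomputable def CommPair.rep (p : CommPair A C) : MaxTensor A C →⋆ₙₐ[ℂ] (p.H →L[ℂ] p.H) where
  toFun z := z.1 p
  map_smul' _ _ := rfl
  map_zero' := rfl
  map_add' _ _ := rfl
  map_mul' _ _ := rfl
  map_star' _ := rfl

/-- The representation of the maximal tensor product is nondegenerate. -/
def CommPair.Nondegenerate (p : CommPair A C) : Prop :=
  Dense (Submodule.span ℂ {h : p.H | ∃ (z : MaxTensor A C) (k : p.H), h = p.rep z k} : Set p.H)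

end Max

/-- Weak containment of `*`-representations: `π ≺ ρ` if `ker ρ ⊆ ker π`. -/
def WeaklyContained {D : Type*} [NonUnitalNonAssocSemiring D] [DistribMulAction ℂ D] [Star D]
    {H K : Type*}
    [NormedAddCommGroup H] [InnerProductSpace ℂ H] [CompleteSpace H]
    [NormedAddCommGroup K] [InnerProductSpace ℂ K] [CompleteSpace K]
    (π : D →⋆ₙₐ[ℂ] (H →L[ℂ] H)) (ρ : D →⋆ₙₐ[ℂ] (K →L[ℂ] K)) : Prop :=
  ∀ z, ρ z = 0 → π z = 0

/-! ### The universal factorization property -/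

section UFP

variable {A : Type u} [CStarAlgebra A] [PartialOrder A] [StarOrderedRing A]

theorem CommPair.adj_right {C : Type u} [NonUnitalCStarAlgebra C] (σ : CommPair A C) (c : C)
    (x y : (Corr.ofRep σ.σA).carrier) :
    (Corr.ofRep σ.σA).ip (σ.σC (star c) x) y = (Corr.ofRep σ.σA).ip x (σ.σC c y) := by
  have h : ∀ x y : σ.H, inner ℂ (σ.σC (star c) x) y = inner ℂ x (σ.σC c y) := fun x y => by
    rw [StarHomClass.map_star, ContinuousLinearMap.star_eq_adjoint,
      ContinuousLinearMap.adjoint_inner_left]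
  exact h x y

theorem CommPair.comm_right {C : Type u} [NonUnitalCStarAlgebra C] (σ : CommPair A C) (a : A)
    (c : C) (y : (Corr.ofRep σ.σA).carrier) :
    (Corr.ofRep σ.σA).left a (σ.σC c y) = σ.σC c ((Corr.ofRep σ.σA).left a y) :=
  DFunLike.congr_fun (σ.commute a c).eq y

/-- The commuting pair `(π_X ⊗ 1, 1 ⊗ σC)` on the Hilbert space `X ⊗_{σA} H`; its representation of
the maximal tensor product sends `a ⊗ c` to `π_X(a) ⊗ σC(c)`. -/
noncomputable def inducedPair (X : Corr.{u, u, u} A A) {C : Type u} [NonUnitalCStarAlgebra C]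
    (σ : CommPair A C) : CommPair A C where
  H := (X.tensor (Corr.ofRep σ.σA)).carrier
  σA :=
    { (X.tensor (Corr.ofRep σ.σA)).left with
      map_star' := fun a => (ContinuousLinearMap.eq_adjoint_iff _ _).2
        ((X.tensor (Corr.ofRep σ.σA)).left_adj a) }
  σC :=
    { X.tensorRight (Corr.ofRep σ.σA) σ.σC.toNonUnitalAlgHom σ.adj_right σ.comm_right with
      map_star' := fun c => (ContinuousLinearMap.eq_adjoint_iff _ _).2
        (X.tensorRight_adj (Corr.ofRep σ.σA) σ.σC.toNonUnitalAlgHom σ.adj_right σ.comm_right c) }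
  commute a c := X.commute_tensorRight (Corr.ofRep σ.σA) σ.σC.toNonUnitalAlgHom σ.adj_right
    σ.comm_right a c

/-- The universal factorization property: for every C⋆-algebra `C`, each nondegenerate
representation of `A ⊗_max C` is weakly contained in the induced one on `X ⊗_{σA} H`. -/
def UFP (X : Corr.{u, u, u} A A) : Prop :=
  ∀ (C : Type u) [NonUnitalCStarAlgebra C] (σ : CommPair A C), σ.Nondegenerate →
    WeaklyContained σ.rep (inducedPair X σ).rep

end UFP

/-! ### Conditional expectations and relative nuclearity -/

section Nuclear

variable {A B : Type u} [CStarAlgebra A] [PartialOrder A] [StarOrderedRing A]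
  [CStarAlgebra B] [PartialOrder B] [StarOrderedRing B]

/-- A conditional expectation for the unital inclusion `ι : B → A`: a positive linear
`B`-bimodule map onto `B` that restricts to the identity of `B`. (Complete positivity and
contractivity are automatic; so is the injectivity of `ι`, by `map_ι`.) -/
structure CondExp (ι : B →⋆ₐ[ℂ] A) extends A →ₗ[ℂ] B where
  map_nonneg : ∀ a : A, 0 ≤ a → 0 ≤ toFun a
  map_ι : ∀ b : B, toFun (ι b) = b
  map_bimod : ∀ (b b' : B) (a : A), toFun (ι b * a * ι b') = b * toFun a * b'

variable {ι : B →⋆ₐ[ℂ] A} (E : CondExp ι)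

theorem CondExp.map_star (a : A) : E.toLinearMap (star a) = star (E.toLinearMap a) := by
  let F : A →ₚ[ℂ] B := PositiveLinearMap.mk₀ E.toLinearMap E.map_nonneg
  exact StarHomClass.map_star F a

/-- The semi-inner product `⟨a, b⟩ = E(a⋆ b)` on `A`. -/
noncomputable def CondExp.semi : SemiIP B A where
  ip := LinearMap.mk₂'ₛₗ (starRingEnd ℂ) (RingHom.id ℂ) (fun a b => E.toLinearMap (star a * b))
    (fun x y z => by simp [add_mul]) (fun c x y => by simp) (fun x y z => by simp [mul_add])
    (fun c x y => by simp)
  ract b a := a * ι b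
  ip_ract x y b := by
    change E.toLinearMap (star x * (y * ι b)) = E.toLinearMap (star x * y) * b
    have h := E.map_bimod 1 b (star x * y)
    rwa [map_one, one_mul, one_mul, mul_assoc] at h
  star_ip x y := by
    change star (E.toLinearMap (star x * y)) = E.toLinearMap (star y * x)
    rw [← E.map_star, star_mul, star_star]
  nonneg x := E.map_nonneg _ (star_mul_self_nonneg x)

/-- The GNS correspondence `L²(A, E)`, with left action by left multiplication. -/
noncomputable def CondExp.L2 : Corr.{u, u, u} A B :=
  E.semi.corr (NonUnitalAlgHom.lmul ℂ A) (fun a x y => by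
    change E.toLinearMap (star (star a * x) * y) = E.toLinearMap (star x * (a * y))
    rw [star_mul, star_star, mul_assoc])

/-- The C⋆-algebra `A` as a `B`-`A` correspondence: `⟨x, y⟩ = x⋆ y`, with `B` acting on the left
through the inclusion `ι`. -/
noncomputable def algCorr (ι : B →⋆ₐ[ℂ] A) : Corr.{u, u, u} B A where
  carrier := A
  ip := LinearMap.mk₂'ₛₗ (starRingEnd ℂ) (RingHom.id ℂ) (fun a b => star a * b)
    (fun x y z => by simp [add_mul]) (fun c x y => by simp) (fun x y z => by simp [mul_add])
    (fun c x y => by simp)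
  ip_smul x y a := (mul_assoc (star x) y a).symm
  star_ip x y := by
    change star (star x * y) = star y * x
    rw [star_mul, star_star]
  ip_nonneg x := star_mul_self_nonneg x
  norm_eq x := by
    change ‖x‖ = √‖star x * x‖
    rw [CStarRing.norm_star_mul_self, Real.sqrt_mul_self (norm_nonneg x)]
  left :=
    { toFun := fun b => ContinuousLinearMap.mul ℂ A (ι b)
      map_smul' := fun z b => by ext; simp
      map_zero' := by ext; simp
      map_add' := fun b c => by ext; simp
      map_mul' := fun b c => by ext; simp [mul_assoc] }
  left_adj b x y := by
    change star (ι (star b) * x) * y = star x * (ι b * y)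
    rw [star_mul, StarHomClass.map_star, star_star, mul_assoc]

/-- Nuclearity of the triple `(A, B, E)`. -/
def CondExp.IsNuclear : Prop := UFP (E.L2.tensor (algCorr ι))

end Nuclear

end RelNuc

namespace RelNuc

set_option linter.unusedSectionVars false

/-! ### Completely positive maps given by `E` and by conjugation -/

section CompletelyPositive

section CP

variable {A : Type*} [CStarAlgebra A] [PartialOrder A] [StarOrderedRing A]

/-! Write `X` for `L²(A, E) ⊗_B A`. The link between the two conditions is that `∑ ψₖ ∘ φₖ` is the
map `a ↦ ∑ ⟨ξₖ, a ξₖ⟩` with `ξₖ = ∑ xₖᵢ ⊗ yₖᵢ` in `X` (`CondExp.factorMap_eq_ip`). These maps form a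
convex cone, and the vectors `∑ xᵢ ⊗ yᵢ` are dense in `X`.

Approximation implies nuclearity: let `θ = ∑ ψₖ ∘ φₖ`. The diagonal matrix coefficient of `∑ θ(aᵢ) ⊗
cᵢ` at `h` equals the sum over `k` of those of `∑ aᵢ ⊗ cᵢ` in the induced representation at `ξₖ ⊗
h`, and `∑ ‖ξₖ ⊗ h‖² ≤ ‖θ(1)‖ ‖h‖²`. When `θ` is close to the identity on `1` and the `aᵢ`, this
gives in the limit `|⟨h, σ(z) h⟩| ≤ ‖h‖² ‖φ_X^H(z)‖` (`CondExp.norm_inner_sum_le`). The estimate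
passes to the closure and yields the inclusion of kernels.

Nuclearity implies approximation: if self-adjoint `aᵢ` cannot be approximated by the cone,
Hahn-Banach gives positive functionals `fᵢ` with `∑ fᵢ(aᵢ) > 0` and `∑ fᵢ(θ(aᵢ)) ≤ 0` on the cone
(`exists_positive_functionals`). In the GNS representation of `ω = ∑ fᵢ`, with cyclic vector `Ω`, a
Radon-Nikodym argument (`exists_gns_derivative`) writes `fᵢ(b) = ⟨Ω, b Tᵢ Ω⟩` with self-adjoint `Tᵢ`
in the commutant. Take `C` to be that commutant and `z = ∑ aᵢ ⊗ Tᵢ`. The inequality on the cone says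
that the induced image of `z` is negative on the vectors `ξ ⊗ Ω`, which are dense
(`CondExp.dense_vec_tmul`). Inclusion of kernels preserves negativity
(`re_inner_nonpos_of_weaklyContained`), so `∑ fᵢ(aᵢ) = ⟨Ω, σ(z) Ω⟩ ≤ 0`, a contradiction. -/

theorem sum_conj_nonneg {n : ℕ} {M : CStarMatrix (Fin n) (Fin n) A} (hM : 0 ≤ M) (c : Fin n → A) :
    0 ≤ ∑ i, ∑ j, star (c i) * M i j * c j := by
  obtain ⟨N, hN⟩ := exists_eq_star_mul_self hM
  have h : ∀ i j, M i j = ∑ k, star (N k i) * N k j := fun i j => congrFun (congrFun hN i) j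
  have key : ∑ i, ∑ j, star (c i) * M i j * c j
      = ∑ k, star (∑ i, N k i * c i) * ∑ j, N k j * c j := by
    simp only [h, star_sum, star_mul, Finset.sum_mul, Finset.mul_sum, mul_assoc]
    rw [Finset.sum_congr rfl fun i _ => Finset.sum_comm, Finset.sum_comm]
    exact Finset.sum_congr rfl fun k _ => Finset.sum_comm
  rw [key]
  exact Finset.sum_nonneg fun k _ => star_mul_self_nonneg _

theorem star_apply_of_nonneg {n : ℕ} {M : CStarMatrix (Fin n) (Fin n) A} (hM : 0 ≤ M)
    (i j : Fin n) : star (M i j) = M j i :=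
  congrFun (congrFun (IsSelfAdjoint.of_nonneg hM).star_eq j) i

end CP

theorem sum_comm_pairs {M I J K L : Type*} [AddCommMonoid M] [Fintype I] [Fintype J]
    [Fintype K] [Fintype L] (f : I → J → K → L → M) :
    ∑ p, ∑ q, ∑ i, ∑ j, f p q i j = ∑ i, ∑ j, ∑ p, ∑ q, f p q i j := by
  rw [Finset.sum_congr rfl fun p _ => Finset.sum_comm, Finset.sum_comm]
  refine Finset.sum_congr rfl fun i _ => ?_
  rw [Finset.sum_congr rfl fun p _ => Finset.sum_comm, Finset.sum_comm]

theorem sum_star_mul_mul_sum {R I J K L : Type*} [NonUnitalRing R] [StarRing R] [Fintype I]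
    [Fintype J] [Fintype K] [Fintype L] (u : I → J → R) (v : K → L → R) (a : R) :
    star (∑ i, ∑ s, u i s) * a * ∑ j, ∑ t, v j t
      = ∑ i, ∑ j, ∑ t, ∑ s, star (u i s) * a * v j t := by
  simp only [star_sum, Finset.sum_mul]
  refine Finset.sum_congr rfl fun i _ => ?_
  simp only [Finset.mul_sum]
  rw [Finset.sum_comm]
  exact Finset.sum_congr rfl fun j _ => Finset.sum_comm

theorem cstarMatrix_sum_apply {R I J K : Type*} [AddCommMonoid R] (s : Finset K)
    (f : K → CStarMatrix I J R) (i : I) (j : J) : (∑ k ∈ s, f k) i j = ∑ k ∈ s, f k i j := by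
  classical
  induction s using Finset.induction_on with
  | empty => simp
  | insert k s hk ih => rw [Finset.sum_insert hk, Finset.sum_insert hk, CStarMatrix.add_apply, ih]

variable {A B : Type u} [CStarAlgebra A] [PartialOrder A] [StarOrderedRing A]
  [CStarAlgebra B] [PartialOrder B] [StarOrderedRing B] {ι : B →⋆ₐ[ℂ] A} (E : CondExp ι)

theorem CondExp.map_ι_mul_mul_ι (b b' : B) (a : A) :
    E.toLinearMap (ι b * a * ι b') = b * E.toLinearMap a * b' :=
  E.map_bimod b b' a

/-- The completely positive map `a ↦ [E(xᵢ⋆ a xⱼ)]`. -/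
noncomputable def CondExp.compress {n : ℕ} (x : Fin n → A) :
    A →CP CStarMatrix (Fin n) (Fin n) B where
  toFun a := CStarMatrix.ofMatrix fun i j => E.toLinearMap (star (x i) * a * x j)
  map_add' a b := by
    ext i j
    change E.toLinearMap _ = E.toLinearMap _ + E.toLinearMap _
    simp [mul_add, add_mul]
  map_smul' z a := by
    ext i j
    change E.toLinearMap _ = z • E.toLinearMap _
    simp
  -- A matrix over `M_n(B)` is tested by `matrix_nonneg` twice: against a column `c` over `M_n(B)`,
  -- then against a column `d` over `B`.
  map_cstarMatrix_nonneg' k M hM := by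
    refine matrix_nonneg _ ?_ fun c => ?_
    · ext p q i j
      change star (E.toLinearMap (star (x j) * M q p * x i)) = E.toLinearMap (star (x i) * M p q * x j)
      rw [← E.map_star, star_mul, star_mul, star_star, star_apply_of_nonneg hM, mul_assoc]
    · refine matrix_nonneg _ ?_ fun d => ?_
      · rw [IsSelfAdjoint, star_sum, Finset.sum_comm]
        refine Finset.sum_congr rfl fun p _ => ?_
        rw [star_sum]
        refine Finset.sum_congr rfl fun q _ => ?_
        rw [star_mul, star_mul, star_star, mul_assoc]
        congr 2
        ext i j
        change star (E.toLinearMap (star (x j) * M p q * x i))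
          = E.toLinearMap (star (x i) * M q p * x j)
        rw [← E.map_star, star_mul, star_mul, star_star, star_apply_of_nonneg hM, mul_assoc]
      -- Since `E` is a bimodule map, the coefficients from `B` move inside it. The double quadratic
      -- form is then `E(∑ w_p⋆ M_pq w_q)` with `w_p = ∑ x_s ι(c_p(s,i) d_i)`, so positivity of `E`
      -- suffices.
      · have h := E.map_nonneg _ (sum_conj_nonneg hM
          fun p => ∑ i, ∑ s, x s * ι (c p s i * d i))
        refine h.trans_eq ?_
        change E.toLinearMap _ = _
        simp only [map_sum, sum_star_mul_mul_sum]
        have e : ∀ p q i j, (star (c p) * (CStarMatrix.ofMatrix fun s t =>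
              E.toLinearMap (star (x s) * M p q * x t) : CStarMatrix (Fin n) (Fin n) B) * c q) i j
            = ∑ t, ∑ s, star (c p s i) * E.toLinearMap (star (x s) * M p q * x t) * c q t j := by
          intro p q i j
          rw [CStarMatrix.mul_apply]
          refine Finset.sum_congr rfl fun t _ => ?_
          rw [CStarMatrix.mul_apply, Finset.sum_mul]
          rfl
        have e' : ∀ i j, (∑ p, ∑ q, star (c p) * (CStarMatrix.ofMatrix fun s t =>
              E.toLinearMap (star (x s) * M p q * x t) : CStarMatrix (Fin n) (Fin n) B) * c q) i j
            = ∑ p, ∑ q, ∑ t, ∑ s,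
              star (c p s i) * E.toLinearMap (star (x s) * M p q * x t) * c q t j := by
          intro i j
          rw [cstarMatrix_sum_apply]
          refine Finset.sum_congr rfl fun p _ => ?_
          rw [cstarMatrix_sum_apply]
          exact Finset.sum_congr rfl fun q _ => e p q i j
        refine Eq.trans ?_ (Finset.sum_congr rfl fun i _ => Finset.sum_congr rfl fun j _ =>
          congrArg (fun b => star (d i) * b * d j) (e' i j).symm)
        simp only [Finset.mul_sum, Finset.sum_mul]
        rw [sum_comm_pairs]
        refine Finset.sum_congr rfl fun i _ => Finset.sum_congr rfl fun j _ =>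
          Finset.sum_congr rfl fun p _ => Finset.sum_congr rfl fun q _ =>
          Finset.sum_congr rfl fun t _ => Finset.sum_congr rfl fun s _ => ?_
        have h1 : star (x s * ι (c p s i * d i)) * M p q * (x t * ι (c q t j * d j))
            = ι (star (d i) * star (c p s i)) * (star (x s) * M p q * x t)
              * ι (c q t j * d j) := by
          rw [star_mul, ← StarHomClass.map_star, star_mul]
          simp only [mul_assoc]
        rw [h1, E.map_ι_mul_mul_ι]
        simp only [mul_assoc]

/-- The completely positive map `[bᵢⱼ] ↦ ∑ yᵢ⋆ bᵢⱼ yⱼ`. -/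
noncomputable def rowConj (ι : B →⋆ₐ[ℂ] A) {n : ℕ} (y : Fin n → A) :
    CStarMatrix (Fin n) (Fin n) B →CP A where
  toFun b := ∑ i, ∑ j, star (y i) * ι (b i j) * y j
  map_add' a b := by simp [mul_add, add_mul, Finset.sum_add_distrib]
  map_smul' z a := by simp [Finset.smul_sum]
  map_cstarMatrix_nonneg' k M hM := by
    refine matrix_nonneg _ ?_ fun c => ?_
    · ext p q
      change star (∑ i, ∑ j, star (y i) * ι (M q p i j) * y j)
        = ∑ i, ∑ j, star (y i) * ι (M p q i j) * y j
      have h : ∀ i j, star (M q p i j) = M p q j i := fun i j =>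
        congrFun (congrFun (star_apply_of_nonneg hM q p) j) i
      simp only [star_sum, star_mul, ← StarHomClass.map_star, h, star_star, mul_assoc]
      rw [Finset.sum_comm]
    · obtain ⟨N, hN⟩ := exists_eq_star_mul_self hM
      have h : ∀ p q i j, M p q i j = ∑ r, ∑ s, star (N r p s i) * N r q s j := by
        intro p q i j
        have h1 : M p q = ∑ r, star (N r p) * N r q := congrFun (congrFun hN p) q
        rw [h1, cstarMatrix_sum_apply]
        rfl
      -- With `M = N⋆ N`, the quadratic form becomes a sum of squares indexed by the rows `(r, s)`
      -- of `N`.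
      have key : ∑ p, ∑ q, star (c p) * (∑ i, ∑ j, star (y i) * ι (M p q i j) * y j) * c q
          = ∑ r, ∑ s, star (∑ p, ∑ i, ι (N r p s i) * (y i * c p))
            * ∑ q, ∑ j, ι (N r q s j) * (y j * c q) := by
        have e : ∀ r s, star (∑ p, ∑ i, ι (N r p s i) * (y i * c p))
              * ∑ q, ∑ j, ι (N r q s j) * (y j * c q)
            = ∑ p, ∑ q, ∑ j, ∑ i, star (ι (N r p s i) * (y i * c p))
              * (ι (N r q s j) * (y j * c q)) := by
          intro r s
          simpa using sum_star_mul_mul_sum (fun p i => ι (N r p s i) * (y i * c p))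
            (fun q j => ι (N r q s j) * (y j * c q)) 1
        simp only [e]
        rw [sum_comm_pairs]
        refine Finset.sum_congr rfl fun p _ => Finset.sum_congr rfl fun q _ => ?_
        rw [sum_comm_pairs, Finset.sum_comm]
        simp only [h, map_sum, map_mul, star_mul, StarHomClass.map_star, Finset.sum_mul,
          Finset.mul_sum, mul_assoc]
      refine (Finset.sum_nonneg fun r _ => Finset.sum_nonneg fun s _ =>
        star_mul_self_nonneg _).trans_eq key.symm

end CompletelyPositive

/-! ### Elementary tensors and sums of factorizations through matrix algebras -/

section Factorizations

/-! ### Elementary tensors in the induced Hilbert space -/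

section Induced

variable {A : Type u} [CStarAlgebra A] [PartialOrder A] [StarOrderedRing A]
  (X : Corr.{u, u, u} A A) {C : Type u} [NonUnitalCStarAlgebra C] (σ : CommPair A C)

/-- The elementary tensor `x ⊗ h` in `X ⊗_{σA} H`. -/
noncomputable def inducedTmul : X.carrier →ₗ[ℂ] σ.H →ₗ[ℂ] (inducedPair X σ).H :=
  (TensorProduct.mk ℂ X.carrier (Corr.ofRep σ.σA).carrier).compr₂
    (X.tensorSemi (Corr.ofRep σ.σA)).incl

theorem inner_inducedTmul (x x' : X.carrier) (h h' : σ.H) :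
    inner ℂ (inducedTmul X σ x h) (inducedTmul X σ x' h') = inner ℂ h (σ.σA (X.ip x x') h') :=
  (X.tensorSemi (Corr.ofRep σ.σA)).ipHat_incl _ _

theorem inducedPair_σA_tmul (a : A) (x : X.carrier) (h : σ.H) :
    (inducedPair X σ).σA a (inducedTmul X σ x h) = inducedTmul X σ (X.left a x) h :=
  (X.tensorSemi (Corr.ofRep σ.σA)).rep_incl _ (X.leftAct_adj _) _ _

theorem inducedPair_σC_tmul (c : C) (x : X.carrier) (h : σ.H) :
    (inducedPair X σ).σC c (inducedTmul X σ x h) = inducedTmul X σ x (σ.σC c h) :=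
  (X.tensorSemi (Corr.ofRep σ.σA)).rep_incl
    (X.rightAct (Corr.ofRep σ.σA) σ.σC.toNonUnitalAlgHom)
    (X.rightAct_adj (Corr.ofRep σ.σA) σ.σC.toNonUnitalAlgHom σ.adj_right σ.comm_right) c
    (x ⊗ₜ[ℂ] (show (Corr.ofRep σ.σA).carrier from h))

theorem norm_sq_inducedTmul (x : X.carrier) (h : σ.H) :
    ‖inducedTmul X σ x h‖ ^ 2 = (inner ℂ h (σ.σA (X.ip x x) h)).re := by
  rw [← inner_inducedTmul, ← RCLike.re_eq_complex_re, inner_self_eq_norm_sq]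

theorem norm_inducedTmul_le (x : X.carrier) (h : σ.H) :
    ‖inducedTmul X σ x h‖ ≤ ‖x‖ * ‖h‖ := by
  refine abs_le_of_sq_le_sq' ?_ (by positivity) |>.2
  rw [norm_sq_inducedTmul]
  calc _ ≤ ‖inner ℂ h (σ.σA (X.ip x x) h)‖ := Complex.re_le_norm _
    _ ≤ ‖h‖ * (‖X.ip x x‖ * ‖h‖) := (norm_inner_le_norm _ _).trans <| by
        gcongr
        exact (ContinuousLinearMap.le_opNorm _ _).trans (by
          gcongr; exact NonUnitalStarAlgHom.norm_apply_le _ _)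
    _ = (‖x‖ * ‖h‖) ^ 2 := by
        rw [X.norm_eq, mul_pow, Real.sq_sqrt (norm_nonneg _)]; ring

/-- The tensor product is algebraically only over `ℂ`. Balancing over `A` appears after separation,
because the difference of the two tensors is orthogonal to everything. -/
theorem inducedTmul_smul (x : X.carrier) (a : A) (h : σ.H) :
    inducedTmul X σ (op a • x) h = inducedTmul X σ x (σ.σA a h) := by
  have key : (X.tensorSemi (Corr.ofRep σ.σA)).incl
      ((op a • x) ⊗ₜ[ℂ] (show (Corr.ofRep σ.σA).carrier from h)
        - x ⊗ₜ[ℂ] (Corr.ofRep σ.σA).left a h) = 0 := by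
    refine (X.tensorSemi (Corr.ofRep σ.σA)).incl_eq_zero fun w => ?_
    induction w using TensorProduct.induction_on with
    | zero => simp
    | add z w hz hw => rw [map_add, LinearMap.add_apply, hz, hw, add_zero]
    | tmul x' h' =>
      refine (map_sub (X.tensorIP (Corr.ofRep σ.σA) (x' ⊗ₜ h')) _ _).trans ?_
      rw [Corr.tensorIP_tmul, Corr.tensorIP_tmul, X.ip_smul, map_mul]
      exact sub_self _
  rw [map_sub] at key
  exact sub_eq_zero.1 key

end Induced

variable {A B : Type u} [CStarAlgebra A] [PartialOrder A] [StarOrderedRing A]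
  [CStarAlgebra B] [PartialOrder B] [StarOrderedRing B] {ι : B →⋆ₐ[ℂ] A} (E : CondExp ι)

/-- The map `∑ₖ ψₖ ∘ φₖ` with `φₖ a = [E(xₖᵢ⋆ a xₖⱼ)]` and `ψₖ b = ∑ yₖᵢ⋆ bᵢⱼ yₖⱼ`. -/
noncomputable def CondExp.factorMap {n m : ℕ} (x y : Fin m → Fin n → A) : A →ₗ[ℂ] A :=
  ∑ k, (rowConj ι (y k)).toLinearMap ∘ₗ (E.compress (x k)).toLinearMap

theorem CondExp.factorMap_eq {n m : ℕ} (x y : Fin m → Fin n → A) (a : A) :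
    E.factorMap x y a = ∑ k, rowConj ι (y k) (E.compress (x k) a) := by
  rw [factorMap, LinearMap.sum_apply]
  rfl

theorem CondExp.factorMap_apply {n m : ℕ} (x y : Fin m → Fin n → A) (a : A) :
    E.factorMap x y a = ∑ k, ∑ i, ∑ j,
      star (y k i) * ι (E.toLinearMap (star (x k i) * a * x k j)) * y k j := by
  rw [factorMap_eq]
  rfl

/-- The set of all the maps `∑ₖ ψₖ ∘ φₖ`. -/
def CondExp.factorCone : Set (A →ₗ[ℂ] A) :=
  {θ | ∃ (n m : ℕ) (x y : Fin m → Fin n → A), θ = E.factorMap x y}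

theorem CondExp.zero_mem_factorCone : 0 ∈ E.factorCone :=
  ⟨0, 0, Fin.elim0, Fin.elim0, by simp [factorMap]⟩

theorem CondExp.add_mem_factorCone {θ θ' : A →ₗ[ℂ] A} (h : θ ∈ E.factorCone)
    (h' : θ' ∈ E.factorCone) : θ + θ' ∈ E.factorCone := by
  obtain ⟨n, m, x, y, rfl⟩ := h
  obtain ⟨n', m', x', y', rfl⟩ := h'
  -- All the maps `φₖ` must share one matrix size, so both families are padded with zeros to size `n
  -- + n'`, in complementary blocks.
  refine ⟨n + n', m + m', Fin.append (fun k => Fin.append (x k) 0) (fun k => Fin.append 0 (x' k)),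
    Fin.append (fun k => Fin.append (y k) 0) (fun k => Fin.append 0 (y' k)), ?_⟩
  ext a
  simp [factorMap_apply, Fin.sum_univ_add]

theorem CondExp.smul_mem_factorCone {θ : A →ₗ[ℂ] A} (h : θ ∈ E.factorCone) {t : ℝ} (ht : 0 ≤ t) :
    t • θ ∈ E.factorCone := by
  obtain ⟨n, m, x, y, rfl⟩ := h
  refine ⟨n, m, x, fun k i => √t • y k i, ?_⟩
  ext a
  simp [factorMap_apply, Finset.smul_sum, smul_smul, Real.mul_self_sqrt ht]

/-- The canonical map from `A` to `L²(A, E)`. -/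
noncomputable def CondExp.toL2 : A →ₗ[ℂ] E.L2.carrier := E.semi.incl

theorem CondExp.denseRange_toL2 : DenseRange E.toL2 := E.semi.denseRange_incl

theorem CondExp.left_toL2 (a x : A) : E.L2.left a (E.toL2 x) = E.toL2 (a * x) :=
  E.semi.rep_incl (NonUnitalAlgHom.lmul ℂ A) (fun a x y => by
    change E.toLinearMap (star (star a * x) * y) = E.toLinearMap (star x * (a * y))
    rw [star_mul, star_star, mul_assoc]) a x

theorem CondExp.ip_toL2 (x y : A) :
    E.L2.ip (E.toL2 x) (E.toL2 y) = E.toLinearMap (star x * y) :=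
  E.semi.ipHat_incl x y

/-- The elementary tensor `x ⊗ y` in `L²(A, E) ⊗_B A`. -/
noncomputable def CondExp.tmul (v : E.L2.carrier) (y : A) : (E.L2.tensor (algCorr ι)).carrier :=
  (E.L2.tensorSemi (algCorr ι)).incl (v ⊗ₜ[ℂ] (show (algCorr ι).carrier from y))

theorem CondExp.ip_tmul (v w : E.L2.carrier) (y z : A) :
    (E.L2.tensor (algCorr ι)).ip (E.tmul v y) (E.tmul w z)
      = star y * (ι (E.L2.ip v w) * z) :=
  (E.L2.tensorSemi (algCorr ι)).ipHat_incl _ _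

theorem CondExp.left_tmul (a : A) (v : E.L2.carrier) (y : A) :
    (E.L2.tensor (algCorr ι)).left a (E.tmul v y) = E.tmul (E.L2.left a v) y :=
  (E.L2.tensorSemi (algCorr ι)).rep_incl _ (E.L2.leftAct_adj _) _ _

/-- The vector `∑ xᵢ ⊗ yᵢ` of `L²(A, E) ⊗_B A`. -/
noncomputable def CondExp.vec {n : ℕ} (x y : Fin n → A) : (E.L2.tensor (algCorr ι)).carrier :=
  ∑ i, E.tmul (E.toL2 (x i)) (y i)

theorem CondExp.left_vec {n : ℕ} (x y : Fin n → A) (a : A) :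
    (E.L2.tensor (algCorr ι)).left a (E.vec x y) = E.vec (fun i => a * x i) y := by
  simp only [vec, map_sum, left_tmul, left_toL2]

theorem CondExp.left_one_vec {n : ℕ} (x y : Fin n → A) :
    (E.L2.tensor (algCorr ι)).left 1 (E.vec x y) = E.vec x y := by
  simp only [left_vec, one_mul]

theorem CondExp.ip_vec {n : ℕ} (x y : Fin n → A) (a : A) :
    (E.L2.tensor (algCorr ι)).ip (E.vec x y) ((E.L2.tensor (algCorr ι)).left a (E.vec x y))
      = ∑ i, ∑ j, star (y i) * ι (E.toLinearMap (star (x i) * a * x j)) * y j := by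
  rw [left_vec]
  simp only [vec, map_sum, LinearMap.sum_apply, ip_tmul, ip_toL2, mul_assoc]
  rw [Finset.sum_comm]

/-- This turns sums of factorizations into sums of matrix coefficients of `X`, the form in which
both directions use them. -/
theorem CondExp.factorMap_eq_ip {n m : ℕ} (x y : Fin m → Fin n → A) (a : A) :
    E.factorMap x y a = ∑ k, (E.L2.tensor (algCorr ι)).ip (E.vec (x k) (y k))
      ((E.L2.tensor (algCorr ι)).left a (E.vec (x k) (y k))) := by
  simp only [ip_vec, factorMap_apply]

/-! ### Algebraic elements of the maximal tensor product -/

theorem mem_span_of_mem_adjoin {R : Type*} [NonUnitalRing R] [StarRing R] [Module ℂ R]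
    [IsScalarTower ℂ R R] [SMulCommClass ℂ R R] [StarModule ℂ R] {s : Set R}
    (hmul : ∀ x ∈ s, ∀ y ∈ s, x * y ∈ s) (hstar : ∀ x ∈ s, star x ∈ s) {z : R}
    (hz : z ∈ NonUnitalStarAlgebra.adjoin ℂ s) : z ∈ Submodule.span ℂ s := by
  induction hz using NonUnitalStarAlgebra.adjoin_induction with
  | mem x hx => exact Submodule.subset_span hx
  | add x y _ _ hx hy => exact add_mem hx hy
  | zero => exact zero_mem _
  | smul r x _ hx => exact Submodule.smul_mem _ r hx
  | mul x y hx' hy' hx hy =>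
    clear hx' hy'
    induction hx, hy using Submodule.span_induction₂ with
    | mem_mem x y hx hy => exact Submodule.subset_span (hmul x hx y hy)
    | zero_left y _ => rw [zero_mul]; exact zero_mem _
    | zero_right x _ => rw [mul_zero]; exact zero_mem _
    | add_left x y z _ _ _ hx hy => rw [add_mul]; exact add_mem hx hy
    | add_right x y z _ _ _ hx hy => rw [mul_add]; exact add_mem hx hy
    | smul_left r x y _ _ h => rw [smul_mul_assoc]; exact Submodule.smul_mem _ _ h
    | smul_right r x y _ _ h => rw [mul_smul_comm]; exact Submodule.smul_mem _ _ h
  | star x hx' hx =>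
    clear hx'
    induction hx using Submodule.span_induction with
    | mem x hx => exact Submodule.subset_span (hstar x hx)
    | zero => rw [star_zero]; exact zero_mem _
    | add x y _ _ hx hy => rw [star_add]; exact add_mem hx hy
    | smul r x _ hx => rw [star_smul]; exact Submodule.smul_mem _ _ hx

theorem pureTensor_mul {C : Type u} [NonUnitalCStarAlgebra C] (a a' : A) (c c' : C) :
    pureTensor a c * pureTensor a' c' = pureTensor (a * a') (c * c') := by
  ext p : 2
  change p.σA a * p.σC c * (p.σA a' * p.σC c') = p.σA (a * a') * p.σC (c * c')
  rw [map_mul, map_mul, mul_assoc, ← mul_assoc (p.σC c), (p.commute a' c).symm.eq]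
  simp only [mul_assoc]

theorem star_pureTensor {C : Type u} [NonUnitalCStarAlgebra C] (a : A) (c : C) :
    star (pureTensor a c) = pureTensor (star a) (star c) := by
  ext p : 2
  change star (p.σA a * p.σC c) = p.σA (star a) * p.σC (star c)
  rw [star_mul, ← map_star, ← map_star, (p.commute _ _).eq]

/-- Elementary tensors are closed under product and adjoint, so the algebra they generate is their
span. The same `a` and `c` serve for all pairs `p`, which allows `σ` to be compared with its induced
pair. -/
theorem exists_sum_of_mem_adjoin {C : Type u} [NonUnitalCStarAlgebra C] {z : UnivProd A C}
    (hz : z ∈ NonUnitalStarAlgebra.adjoin ℂ (Set.range fun q : A × C => pureTensor q.1 q.2)) :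
    ∃ (l : ℕ) (a : Fin l → A) (c : Fin l → C), ∀ p, z p = ∑ i, p.σA (a i) * p.σC (c i) := by
  have h := mem_span_of_mem_adjoin ?_ ?_ hz
  · clear hz
    induction h using Submodule.span_induction with
    | mem x hx =>
      obtain ⟨q, rfl⟩ := hx
      exact ⟨1, fun _ => q.1, fun _ => q.2, fun p => by simp; rfl⟩
    | zero => exact ⟨0, Fin.elim0, Fin.elim0, fun p => by simp⟩
    | add x y _ _ hx hy =>
      obtain ⟨l, a, c, h⟩ := hx
      obtain ⟨l', a', c', h'⟩ := hy
      refine ⟨l + l', Fin.append a a', Fin.append c c', fun p => ?_⟩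
      simp only [Fin.sum_univ_add, Fin.append_left, Fin.append_right, ← h, ← h']
      rfl
    | smul r x _ hx =>
      obtain ⟨l, a, c, h⟩ := hx
      -- The scalar is absorbed into the first tensor factor.
      refine ⟨l, fun i => r • a i, c, fun p => ?_⟩
      simp only [map_smul, smul_mul_assoc, ← Finset.smul_sum, ← h]
      rfl
  · rintro _ ⟨q, rfl⟩ _ ⟨q', rfl⟩
    exact ⟨(q.1 * q'.1, q.2 * q'.2), (pureTensor_mul _ _ _ _).symm⟩
  · rintro _ ⟨q, rfl⟩
    exact ⟨(star q.1, star q.2), (star_pureTensor _ _).symm⟩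

theorem pureTensor_mem {C : Type u} [NonUnitalCStarAlgebra C] (a : A) (c : C) :
    pureTensor a c ∈ MaxTensor A C :=
  NonUnitalStarSubalgebra.le_topologicalClosure _
    (NonUnitalStarAlgebra.subset_adjoin ℂ _ ⟨(a, c), rfl⟩)

end Factorizations

/-! ### Approximate factorization implies nuclearity -/

section Sufficiency

variable {A B : Type u} [CStarAlgebra A] [PartialOrder A] [StarOrderedRing A]
  [CStarAlgebra B] [PartialOrder B] [StarOrderedRing B] {ι : B →⋆ₐ[ℂ] A} (E : CondExp ι)

theorem norm_one_le_one : ‖(1 : A)‖ ≤ 1 := by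
  rcases subsingleton_or_nontrivial A with h | h
  · simp [Subsingleton.elim (1 : A) 0]
  · exact CStarRing.norm_one.le

/-! ### Matrix coefficients of the induced representation -/

section Compression

variable {C : Type u} [NonUnitalCStarAlgebra C] (σ : CommPair A C)

theorem CondExp.sum_inner_inducedTmul {n m : ℕ} (x y : Fin m → Fin n → A) (a : A) (c : C)
    (h : σ.H) :
    ∑ k, inner ℂ (inducedTmul (E.L2.tensor (algCorr ι)) σ (E.vec (x k) (y k)) h)
      (((inducedPair (E.L2.tensor (algCorr ι)) σ).σA a
        * (inducedPair (E.L2.tensor (algCorr ι)) σ).σC c)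
        (inducedTmul (E.L2.tensor (algCorr ι)) σ (E.vec (x k) (y k)) h))
      = inner ℂ h ((σ.σA (E.factorMap x y a) * σ.σC c) h) := by
  simp only [mul_apply_eq_comp, inducedPair_σC_tmul, inducedPair_σA_tmul,
    inner_inducedTmul, factorMap_eq_ip, map_sum]
  rw [_root_.sum_apply, inner_sum]

/-- The left side is `⟨h, σA(θ(1)) h⟩` for `θ = E.factorMap x y`, since `∑ ⟨ξₖ, ξₖ⟩ = θ(1)`. -/
theorem CondExp.sum_norm_sq_inducedTmul_le {n m : ℕ} (x y : Fin m → Fin n → A) (h : σ.H) :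
    ∑ k, ‖inducedTmul (E.L2.tensor (algCorr ι)) σ (E.vec (x k) (y k)) h‖ ^ 2
      ≤ ‖E.factorMap x y 1‖ * ‖h‖ ^ 2 := by
  simp only [norm_sq_inducedTmul]
  have e : ∑ k, (inner ℂ h (σ.σA ((E.L2.tensor (algCorr ι)).ip (E.vec (x k) (y k))
      (E.vec (x k) (y k))) h)).re = (inner ℂ h (σ.σA (E.factorMap x y 1) h)).re := by
    simp only [factorMap_eq_ip, left_one_vec, map_sum]
    rw [_root_.sum_apply, inner_sum, Complex.re_sum]
  rw [e]
  calc _ ≤ ‖inner ℂ h (σ.σA (E.factorMap x y 1) h)‖ := Complex.re_le_norm _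
    _ ≤ ‖h‖ * (‖E.factorMap x y 1‖ * ‖h‖) := (norm_inner_le_norm _ _).trans <| by
        gcongr
        exact (ContinuousLinearMap.le_opNorm _ _).trans (by
          gcongr; exact NonUnitalStarAlgHom.norm_apply_le _ _)
    _ = _ := by ring

/-- Replacing each `aᵢ` by `θ(aᵢ)` costs at most `ε ∑ ‖cᵢ‖ ‖h‖²`. What remains is a sum of
coefficients of the induced operator `T` at vectors of total squared norm at most `(1 + ε) ‖h‖²`. -/
theorem CondExp.norm_inner_sum_le (happ : ∀ (F : Finset A) (ε : ℝ), 0 < ε →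
      ∃ θ ∈ E.factorCone, ∀ a ∈ F, ‖a - θ a‖ < ε)
    {l : ℕ} (a : Fin l → A) (c : Fin l → C) (h : σ.H) :
    ‖inner ℂ h ((∑ i, σ.σA (a i) * σ.σC (c i)) h)‖
      ≤ ‖h‖ ^ 2 * ‖∑ i, (inducedPair (E.L2.tensor (algCorr ι)) σ).σA (a i)
        * (inducedPair (E.L2.tensor (algCorr ι)) σ).σC (c i)‖ := by
  classical
  set T := ∑ i, (inducedPair (E.L2.tensor (algCorr ι)) σ).σA (a i)
        * (inducedPair (E.L2.tensor (algCorr ι)) σ).σC (c i) with hT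
  set S : ℝ := ∑ i, ‖c i‖ with hS
  have hS0 : 0 ≤ S := Finset.sum_nonneg fun i _ => norm_nonneg _
  have main : ∀ ε : ℝ, 0 < ε → ‖inner ℂ h ((∑ i, σ.σA (a i) * σ.σC (c i)) h)‖
      ≤ ε * (S * ‖h‖ ^ 2) + (1 + ε) * (‖h‖ ^ 2 * ‖T‖) := by
    intro ε hε
    -- The unit joins the finite set so that `‖θ(1)‖ ≤ 1 + ε`; contractivity of `θ` is not assumed.
    obtain ⟨_, ⟨n, m, x, y, rfl⟩, hθ⟩ := happ (insert 1 (Finset.univ.image a)) ε hε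
    set v := fun k => inducedTmul (E.L2.tensor (algCorr ι)) σ (E.vec (x k) (y k)) h with hv
    have e1 : ∑ k, inner ℂ (v k) (T (v k))
        = ∑ i, inner ℂ h ((σ.σA (E.factorMap x y (a i)) * σ.σC (c i)) h) := by
      simp only [← sum_inner_inducedTmul, hT, _root_.sum_apply, inner_sum]
      rw [Finset.sum_comm]
    have e2 : inner ℂ h ((∑ i, σ.σA (a i) * σ.σC (c i)) h)
        = ∑ i, inner ℂ h ((σ.σA (a i - E.factorMap x y (a i)) * σ.σC (c i)) h)
          + ∑ k, inner ℂ (v k) (T (v k)) := by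
      rw [e1, ← Finset.sum_add_distrib, _root_.sum_apply, inner_sum]
      refine Finset.sum_congr rfl fun i _ => ?_
      rw [← inner_add_right, map_sub, sub_mul, ← _root_.add_apply, sub_add_cancel]
    rw [e2]
    refine (norm_add_le _ _).trans (add_le_add ?_ ?_)
    · rw [hS, Finset.sum_mul, Finset.mul_sum]
      refine (norm_sum_le _ _).trans (Finset.sum_le_sum fun i _ => ?_)
      calc _ ≤ ‖h‖ * (‖σ.σA (a i - E.factorMap x y (a i)) * σ.σC (c i)‖ * ‖h‖) :=
            (norm_inner_le_norm _ _).trans (by gcongr; exact ContinuousLinearMap.le_opNorm _ _)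
        _ ≤ ‖h‖ * (ε * ‖c i‖ * ‖h‖) := by
            gcongr
            refine (norm_mul_le _ _).trans ?_
            gcongr
            · exact (NonUnitalStarAlgHom.norm_apply_le _ _).trans (hθ _ (by simp)).le
            · exact NonUnitalStarAlgHom.norm_apply_le _ _
        _ = _ := by ring
    · have h1 : ‖E.factorMap x y 1‖ ≤ 1 + ε := by
        have := hθ 1 (by simp)
        have h2 := norm_sub_norm_le (E.factorMap x y 1) 1
        rw [norm_sub_rev] at h2
        linarith [norm_one_le_one (A := A)]
      calc _ ≤ ∑ k, ‖T‖ * ‖v k‖ ^ 2 := by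
            refine (norm_sum_le _ _).trans (Finset.sum_le_sum fun k _ => ?_)
            refine (norm_inner_le_norm _ _).trans ?_
            calc _ ≤ ‖v k‖ * (‖T‖ * ‖v k‖) := by gcongr; exact ContinuousLinearMap.le_opNorm _ _
              _ = _ := by ring
        _ ≤ ‖T‖ * ((1 + ε) * ‖h‖ ^ 2) := by
            rw [← Finset.mul_sum]
            gcongr
            exact (E.sum_norm_sq_inducedTmul_le σ x y h).trans (by gcongr)
        _ = _ := by ring
  refine le_of_forall_pos_le_add fun δ hδ => ?_
  have hR : 0 < S * ‖h‖ ^ 2 + ‖h‖ ^ 2 * ‖T‖ + 1 := by positivity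
  -- The total error is `ε (S ‖h‖² + ‖h‖² ‖T‖)`. The `+ 1` in the denominator keeps it nonzero.
  refine (main (δ / (S * ‖h‖ ^ 2 + ‖h‖ ^ 2 * ‖T‖ + 1)) (by positivity)).trans ?_
  have : δ / (S * ‖h‖ ^ 2 + ‖h‖ ^ 2 * ‖T‖ + 1) * (S * ‖h‖ ^ 2 + ‖h‖ ^ 2 * ‖T‖) ≤ δ := by
    rw [div_mul_eq_mul_div, div_le_iff₀ hR]
    nlinarith
  linarith

end Compression

theorem CondExp.isNuclear_of_approx (happ : ∀ (F : Finset A) (ε : ℝ), 0 < ε →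
      ∃ θ ∈ E.factorCone, ∀ a ∈ F, ‖a - θ a‖ < ε) : E.IsNuclear := by
  intro C _ σ _ z hz
  have key : ∀ (h : σ.H) (w : UnivProd A C), w ∈ MaxTensor A C →
      ‖inner ℂ h (w σ h)‖ ≤ ‖h‖ ^ 2 * ‖w (inducedPair (E.L2.tensor (algCorr ι)) σ)‖ := by
    intro h w hw
    have hc : ∀ p : CommPair A C, Continuous fun w : UnivProd A C => w p := fun p =>
      (continuous_apply p).comp lp.uniformContinuous_coe.continuous
    -- Both sides are continuous in `w`, so the estimate extends from finite sums to their closure.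
    refine closure_minimal (s := (NonUnitalStarAlgebra.adjoin ℂ
      (Set.range fun q : A × C => pureTensor q.1 q.2) : Set (UnivProd A C)))
      (t := {w | ‖inner ℂ h (w σ h)‖
        ≤ ‖h‖ ^ 2 * ‖w (inducedPair (E.L2.tensor (algCorr ι)) σ)‖}) ?_ ?_ hw
    · intro w hw
      obtain ⟨l, a, c, h'⟩ := exists_sum_of_mem_adjoin hw
      rw [Set.mem_ofPred_eq, h', h']
      exact E.norm_inner_sum_le σ happ a c h
    · refine isClosed_le ?_ ?_
      · exact (continuous_const.inner ((hc σ).clm_apply continuous_const)).norm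
      · exact continuous_const.mul (hc _).norm
  -- Over `ℂ`, polarization makes an operator with vanishing quadratic form zero.
  have h0 : (σ.rep z).toLinearMap = 0 := (inner_map_self_eq_zero _).1 fun h => by
    have h1 := key h z.1 z.2
    have h2 : z.1 (inducedPair (E.L2.tensor (algCorr ι)) σ) = 0 := hz
    rw [h2, norm_zero, mul_zero] at h1
    rw [← inner_conj_symm]
    exact (congrArg _ (norm_le_zero_iff.1 h1)).trans (map_zero _)
  ext h
  exact DFunLike.congr_fun h0 h

end Sufficiency

/-! ### Functionals on C⋆-algebras and separation -/

section Functionals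

/-! ### Radon-Nikodym derivatives in the commutant of a GNS representation -/

section RadonNikodym

variable {A : Type*} [CStarAlgebra A] [PartialOrder A] [StarOrderedRing A]

/-- The contraction between GNS spaces induced by the identity of `A`, for `f ≤ ω`. -/
noncomputable def gnsContraction {f ω : A →ₚ[ℂ] ℂ} (hf : ∀ a, 0 ≤ a → f a ≤ ω a) :
    ω.GNS →L[ℂ] f.GNS :=
  (((f.toPreGNS.toLinearMap ∘ₗ ω.ofPreGNS.toLinearMap : ω.PreGNS →ₗ[ℂ] f.PreGNS)).mkContinuous 1
    fun x => by
      rw [one_mul, ← sq_le_sq₀ (norm_nonneg _) (norm_nonneg _), ← Complex.real_le_real,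
        Complex.ofReal_pow, Complex.ofReal_pow, f.preGNS_norm_sq, ω.preGNS_norm_sq]
      exact hf _ (star_mul_self_nonneg _)).completion

theorem gnsContraction_coe {f ω : A →ₚ[ℂ] ℂ} (hf : ∀ a, 0 ≤ a → f a ≤ ω a) (x : A) :
    gnsContraction hf (ω.toPreGNS x : ω.GNS) = (f.toPreGNS x : f.GNS) := by
  simp [gnsContraction]

/-- `T = V⋆ V` for the contraction `V` between the GNS spaces. It commutes with the action because
`⟨x, T a y⟩` and `⟨a⋆ x, T y⟩` both equal `f(x⋆ a y)`. -/
theorem exists_gns_derivative {f ω : A →ₚ[ℂ] ℂ} (hf : ∀ a, 0 ≤ a → f a ≤ ω a) :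
    ∃ T : ω.GNS →L[ℂ] ω.GNS, IsSelfAdjoint T ∧ (∀ a, ω.gnsNonUnitalStarAlgHom a * T
      = T * ω.gnsNonUnitalStarAlgHom a) ∧
      ∀ x y : A, inner ℂ (ω.toPreGNS x : ω.GNS) (T (ω.toPreGNS y : ω.GNS)) = f (star x * y) := by
  set V := gnsContraction hf with hV
  have hin : ∀ x y : A, inner ℂ (ω.toPreGNS x : ω.GNS)
      ((ContinuousLinearMap.adjoint V ∘L V) (ω.toPreGNS y : ω.GNS))
        = f (star x * y) := by
    intro x y
    rw [ContinuousLinearMap.comp_apply, ContinuousLinearMap.adjoint_inner_right, hV, gnsContraction_coe,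
      gnsContraction_coe, UniformSpace.Completion.inner_coe, f.preGNS_inner_def]
    rfl
  refine ⟨ContinuousLinearMap.adjoint V ∘L V, ?_, fun a => ?_, hin⟩
  · rw [IsSelfAdjoint, ContinuousLinearMap.star_eq_adjoint, ContinuousLinearMap.adjoint_comp,
      ContinuousLinearMap.adjoint_adjoint]
  · ext y
    refine ext_inner_left ℂ fun x => ?_
    set T := ContinuousLinearMap.adjoint V ∘L V
    induction x, y using UniformSpace.Completion.induction_on₂ with
    | hp => apply isClosed_eq <;> fun_prop
    | ih x y =>
      have h1 : (ω.gnsNonUnitalStarAlgHom a) (y : ω.GNS)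
          = (ω.toPreGNS (a * ω.ofPreGNS y) : ω.GNS) := by simp
      have h2 : (ω.gnsNonUnitalStarAlgHom (star a)) (x : ω.GNS)
          = (ω.toPreGNS (star a * ω.ofPreGNS x) : ω.GNS) := by simp
      have h3 := hin (ω.ofPreGNS x) (a * ω.ofPreGNS y)
      have h4 := hin (star a * ω.ofPreGNS x) (ω.ofPreGNS y)
      rw [mul_apply_eq_comp, mul_apply_eq_comp, h1, ← ContinuousLinearMap.adjoint_inner_left,
        ← ContinuousLinearMap.star_eq_adjoint, ← map_star, h2]
      refine h4.trans (Eq.trans ?_ h3.symm)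
      rw [star_mul, star_star, mul_assoc]

end RadonNikodym

/-! ### Weak containment and order -/

section Order

/-- If `ρ(w) ≤ 0`, then `w⁺ w w⁺ = (w⁺)³` forces `ρ(w⁺) = 0`. Hence `π(w⁺) = 0` by inclusion of
kernels, and `π(w) = -π(w⁻) ≤ 0`. -/
theorem re_inner_nonpos_of_weaklyContained {D : Type*} [NonUnitalCStarAlgebra D] {H K : Type*}
    [NormedAddCommGroup H] [InnerProductSpace ℂ H] [CompleteSpace H]
    [NormedAddCommGroup K] [InnerProductSpace ℂ K] [CompleteSpace K]
    {π : D →⋆ₙₐ[ℂ] (H →L[ℂ] H)} {ρ : D →⋆ₙₐ[ℂ] (K →L[ℂ] K)} (hπ : WeaklyContained π ρ)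
    {w : D} (hw : IsSelfAdjoint w) (hρ : ∀ v, (inner ℂ v (ρ w v)).re ≤ 0) (h : H) :
    (inner ℂ h (π w h)).re ≤ 0 := by
  let _ := CStarAlgebra.spectralOrder D
  let _ := CStarAlgebra.spectralOrderedRing D
  have hadj : ∀ (d : D) (x y : K), inner ℂ (ρ d x) y = inner ℂ x (ρ (star d) y) := fun d x y => by
    rw [map_star, ContinuousLinearMap.star_eq_adjoint, ContinuousLinearMap.adjoint_inner_right]
  have hadj' : ∀ (d : D) (x y : H), inner ℂ (π d x) y = inner ℂ x (π (star d) y) :=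
    fun d x y => by
    rw [map_star, ContinuousLinearMap.star_eq_adjoint, ContinuousLinearMap.adjoint_inner_right]
  have hp : 0 ≤ w⁺ := CFC.posPart_nonneg w
  have hs : star w⁺ = w⁺ := (IsSelfAdjoint.of_nonneg hp).star_eq
  obtain ⟨Q, hQ⟩ := CStarAlgebra.nonneg_iff_eq_star_mul_self.1 hp
  obtain ⟨R, hR⟩ := CStarAlgebra.nonneg_iff_eq_star_mul_self.1 (CFC.negPart_nonneg w)
  have hdec := CFC.posPart_sub_negPart w hw
  -- Writing `(w⁺)³` as a square makes the form of `ρ(w)` at `ρ(w⁺) v` equal to `‖ρ(Q w⁺) v‖²`,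
  -- which the hypothesis bounds above by zero.
  have hcube : w⁺ * w * w⁺ = star (Q * w⁺) * (Q * w⁺) := by
    have : w⁺ * w = w⁺ * w⁺ := by
      nth_rewrite 2 [← hdec]
      rw [mul_sub, CFC.posPart_mul_negPart, sub_zero]
    rw [this, star_mul, hs, mul_assoc w⁺ (star Q), ← mul_assoc (star Q), ← hQ, mul_assoc]
  have h1 : ρ (Q * w⁺) = 0 := by
    ext v
    have h2 := hρ (ρ w⁺ v)
    rw [hadj, hs, ← mul_apply_eq_comp, ← mul_apply_eq_comp, ← map_mul, ← map_mul, hcube,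
      map_mul, mul_apply_eq_comp, ← hadj, ← RCLike.re_eq_complex_re, inner_self_eq_norm_sq] at h2
    have : ‖ρ (Q * w⁺) v‖ = 0 := by nlinarith [norm_nonneg (ρ (Q * w⁺) v)]
    simpa using this
  have h3 : ρ w⁺ = 0 := by
    have : star (ρ w⁺) * ρ w⁺ = 0 := by
      rw [← map_star, hs, ← map_mul]
      nth_rewrite 1 [hQ]
      rw [mul_assoc, map_mul, h1, mul_zero]
    exact (CStarRing.star_mul_self_eq_zero_iff _).1 this
  have h4 := hπ _ h3
  have h5 : π w = -(π (star R) * π R) := by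
    rw [← map_mul, ← hR]
    conv_lhs => rw [← hdec]
    rw [map_sub, h4, zero_sub]
  rw [h5, neg_apply, inner_neg_right, mul_apply_eq_comp, ← hadj', Complex.neg_re,
    ← RCLike.re_eq_complex_re, inner_self_eq_norm_sq]
  nlinarith [norm_nonneg (π R h)]

/-- A closed `*`-subalgebra is itself a C⋆-algebra, so the positive part of `w` can be taken inside
`S`, where the representations are defined. -/
theorem re_inner_nonpos_of_weaklyContained_subalgebra {R : Type*} [NonUnitalCStarAlgebra R]
    {S : NonUnitalStarSubalgebra ℂ R} [hS : IsClosed (S : Set R)] {H K : Type*}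
    [NormedAddCommGroup H] [InnerProductSpace ℂ H] [CompleteSpace H]
    [NormedAddCommGroup K] [InnerProductSpace ℂ K] [CompleteSpace K]
    {π : S →⋆ₙₐ[ℂ] (H →L[ℂ] H)} {ρ : S →⋆ₙₐ[ℂ] (K →L[ℂ] K)} (hπ : WeaklyContained π ρ)
    {w : S} (hw : IsSelfAdjoint w) (hρ : ∀ v, (inner ℂ v (ρ w v)).re ≤ 0) (h : H) :
    (inner ℂ h (π w h)).re ≤ 0 :=
  re_inner_nonpos_of_weaklyContained hπ hw hρ h

end Order

/-! ### One-sided approximation and its Hahn-Banach dual -/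

section Separation

variable {A : Type*} [CStarAlgebra A] [PartialOrder A] [StarOrderedRing A]

theorem nonpos_of_forall_mul_le {x c : ℝ} (h : ∀ s : ℝ, 0 ≤ s → s * x ≤ c) : x ≤ 0 := by
  by_contra! hx
  have h0 : 0 ≤ c := by simpa using h 0 le_rfl
  have := h ((c + 1) / x) (by positivity)
  rw [div_mul_cancel₀ _ hx.ne'] at this
  linarith

/-- The elements that differ by less than `ε` from the negative of an accretive element. -/
def nearDissipative (A : Type*) [CStarAlgebra A] [PartialOrder A] (ε : ℝ) : Set A :=
  {b | ∃ p : A, 0 ≤ p + star p ∧ ‖b + p‖ < ε}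

theorem isOpen_nearDissipative (ε : ℝ) : IsOpen (nearDissipative A ε) := by
  have : nearDissipative A ε = ⋃ p ∈ {p : A | 0 ≤ p + star p}, {b | ‖b + p‖ < ε} := by
    ext b; simp [nearDissipative]
  rw [this]
  exact isOpen_biUnion fun p _ => isOpen_lt (by fun_prop) (by fun_prop)

theorem convex_nearDissipative (ε : ℝ) : Convex ℝ (nearDissipative A ε) := by
  rintro b ⟨p, hp, hb⟩ b' ⟨p', hp', hb'⟩ s t hs ht hst
  refine ⟨s • p + t • p', ?_, ?_⟩
  · have : s • p + t • p' + star (s • p + t • p') = s • (p + star p) + t • (p' + star p') := by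
      simp only [star_add, star_smul, star_trivial, smul_add]
      abel
    rw [this]
    exact add_nonneg (smul_nonneg hs hp) (smul_nonneg ht hp')
  · have := convex_ball (0 : A) ε (by simpa using hb) (by simpa using hb') hs ht hst
    rw [mem_ball_zero_iff] at this
    refine lt_of_eq_of_lt (congrArg _ ?_) this
    module

/-- For self-adjoint `b`, the real part of `b + p` lies above `b` and below its norm, so `b ≤ ε`.
Applying this to `-b` as well gives the norm bound. -/
theorem norm_le_of_mem_nearDissipative {b : A} (hb : IsSelfAdjoint b) {ε : ℝ}
    (h : b ∈ nearDissipative A ε) (h' : -b ∈ nearDissipative A ε) : ‖b‖ ≤ ε := by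
  have key : ∀ c : A, IsSelfAdjoint c → c ∈ nearDissipative A ε → c ≤ algebraMap ℝ A ε := by
    rintro c hc ⟨p, hp, hcp⟩
    set r : A := (2⁻¹ : ℝ) • (c + p + star (c + p)) with hr
    have hrs : IsSelfAdjoint r := (IsSelfAdjoint.all _).smul (IsSelfAdjoint.add_star_self (c + p))
    have hrn : ‖r‖ ≤ ε := by
      rw [hr, norm_smul]
      have := norm_add_le (c + p) (star (c + p))
      rw [norm_star] at this
      rw [Real.norm_of_nonneg (by norm_num)]
      linarith
    have hcr : r = c + (2⁻¹ : ℝ) • (p + star p) := by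
      rw [hr, star_add, hc.star_eq]
      module
    calc c ≤ r := by
          rw [hcr]
          exact le_add_of_nonneg_right (smul_nonneg (by norm_num) hp)
      _ ≤ algebraMap ℝ A ‖r‖ := hrs.le_algebraMap_norm_self
      _ ≤ algebraMap ℝ A ε := algebraMap_mono A hrn
  rcases subsingleton_or_nontrivial A with hA | hA
  · obtain ⟨p, _, hp⟩ := h
    rw [Subsingleton.elim b 0, norm_zero]
    exact (norm_nonneg _).trans hp.le
  · rcases CStarAlgebra.norm_or_neg_norm_mem_spectrum hb with h1 | h1
    · exact (le_algebraMap_iff_spectrum_le (ha := hb)).1 (key b hb h) _ h1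
    · refine (le_algebraMap_iff_spectrum_le (ha := hb.neg)).1 (key (-b) hb.neg h') _ ?_
      rw [← spectrum.neg_eq]
      simpa using h1

/-- Separation by arbitrary functionals would give nothing to represent on a GNS space. The sets
`nearDissipative A ε` are stable under subtraction of accretive elements, and this forces each
component of the separating functional to be positive. -/
theorem exists_positive_functionals {I : Type*} [Fintype I] (a : I → A) {ε : ℝ} (hε : 0 < ε)
    {K : Set (A →ₗ[ℂ] A)} (h0 : 0 ∈ K) (hadd : ∀ θ ∈ K, ∀ θ' ∈ K, θ + θ' ∈ K)
    (hsmul : ∀ θ ∈ K, ∀ t : ℝ, 0 ≤ t → t • θ ∈ K)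
    (hno : ¬ ∃ θ ∈ K, ∀ i, a i - θ (a i) ∈ nearDissipative A ε) :
    ∃ f : I → (A →ₚ[ℂ] ℂ), 0 < ∑ i, (f i (a i)).re ∧ ∀ θ ∈ K, ∑ i, (f i (θ (a i))).re ≤ 0 := by
  classical
  have hzero : ∀ s : ℝ, 0 ≤ s → ∀ p : A, 0 ≤ p + star p → -(s • p) ∈ nearDissipative A ε :=
    fun s hs p hp => ⟨s • p, by
      rw [star_smul, star_trivial, ← smul_add]; exact smul_nonneg hs hp, by simpa using hε⟩
  obtain ⟨F, u, hFU, hFK⟩ := RCLike.geometric_hahn_banach_open (𝕜 := ℂ)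
    (s := Set.univ.pi fun _ : I => nearDissipative A ε)
    (t := (fun θ : A →ₗ[ℂ] A => fun i => a i - θ (a i)) '' K)
    (convex_pi fun _ _ => convex_nearDissipative ε)
    (isOpen_set_pi Set.finite_univ fun _ _ => isOpen_nearDissipative ε)
    (by
      rintro _ ⟨θ, hθ, rfl⟩ _ ⟨θ', hθ', rfl⟩ s t hs ht hst
      refine ⟨s • θ + t • θ', hadd _ (hsmul _ hθ _ hs) _ (hsmul _ hθ' _ ht), ?_⟩
      ext i
      have : a i = s • a i + t • a i := by rw [← add_smul, hst, one_smul]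
      simp only [LinearMap.add_apply, LinearMap.smul_apply, Pi.add_apply, Pi.smul_apply, smul_sub]
      nth_rewrite 1 [this]
      abel)
    (by
      rw [Set.disjoint_right]
      rintro _ ⟨θ, hθ, rfl⟩ h
      exact hno ⟨θ, hθ, fun i => h i (Set.mem_univ i)⟩)
  have hF : ∀ b : I → A, F b = ∑ i, F (Pi.single i (b i)) := fun b => by
    rw [← map_sum, Finset.univ_sum_single]
  have hu : 0 < u := by
    simpa using hFU 0 fun i _ => by simpa using hzero 0 le_rfl 0 (by simp)
  -- Since `-s p` lies in the open set for all `s ≥ 0`, the bound `u` holds along a whole ray, which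
  -- fixes the sign.
  have hacc : ∀ i, ∀ p : A, 0 ≤ p + star p → 0 ≤ (F (Pi.single i p)).re := by
    intro i p hp
    refine neg_nonpos.1 (nonpos_of_forall_mul_le (c := u) fun s hs => ?_)
    have := hFU (Pi.single i (-(s • p))) fun j _ => by
      rcases eq_or_ne j i with rfl | hj
      · simpa using hzero s hs p hp
      · simpa [hj] using hzero 0 le_rfl 0 (by simp)
    have e : Pi.single i (-(s • p)) = (-(s : ℂ)) • (Pi.single i p : I → A) := by
      rw [← Pi.single_smul]; simp
    rw [e, map_smul] at this
    simpa using this.le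
  let f : I → (A →ₚ[ℂ] ℂ) := fun i => PositiveLinearMap.mk₀
    (F.toLinearMap ∘ₗ LinearMap.single ℂ (fun _ => A) i) fun p hp => by
      change 0 ≤ F (Pi.single i p)
      have hps : star p = p := (IsSelfAdjoint.of_nonneg hp).star_eq
      have e : ∀ c : ℂ, F (Pi.single i (c • p)) = c * F (Pi.single i p) := fun c => by
        rw [← smul_eq_mul, ← map_smul, Pi.single_smul]
      have h1 := hacc i p (by rw [hps]; exact add_nonneg hp hp)
      -- Both `i p` and `-i p` are accretive when `p` is self-adjoint, so the functional has zero
      -- imaginary part at `p`.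
      have h2 := hacc i (Complex.I • p) (by simp [star_smul, hps])
      have h3 := hacc i (-Complex.I • p) (by simp [star_smul, hps])
      rw [e] at h2 h3
      simp at h2 h3
      exact Complex.nonneg_iff.2 ⟨h1, le_antisymm h3 h2⟩
  have hf : ∀ i x, f i x = F (Pi.single i x) := fun i x => rfl
  refine ⟨f, ?_, fun θ hθ => ?_⟩
  · have h1 := hFK _ ⟨0, h0, rfl⟩
    rw [hF] at h1
    simp only [hf]
    simpa using hu.trans_le h1
  -- `K` is stable under nonnegative scaling, so the separating inequality holds for all `s • θ`;
  -- let `s` grow.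
  · refine nonpos_of_forall_mul_le (c := ∑ i, (f i (a i)).re) fun s hs => ?_
    have h1 := hu.le.trans (hFK _ ⟨s • θ, hsmul θ hθ s hs, rfl⟩)
    rw [hF] at h1
    simp only [hf]
    have e : ∀ i, (F (Pi.single i (a i - (s • θ) (a i)))).re
        = (F (Pi.single i (a i))).re - s * (F (Pi.single i (θ (a i)))).re := by
      intro i
      have : Pi.single i (a i - (s • θ) (a i))
          = (Pi.single i (a i) : I → A) - (s : ℂ) • (Pi.single i (θ (a i)) : I → A) := by
        rw [← Pi.single_smul, ← Pi.single_sub]; simp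
      rw [this, map_sub, map_smul]
      simp
    have h2 : 0 ≤ ∑ i, (F (Pi.single i (a i - (s • θ) (a i)))).re := by simpa using h1
    simp only [e, Finset.sum_sub_distrib, ← Finset.mul_sum] at h2
    linarith

end Separation

end Functionals

/-! ### Nuclearity implies approximate factorization -/

section Necessity

variable {A B : Type u} [CStarAlgebra A] [PartialOrder A] [StarOrderedRing A]
  [CStarAlgebra B] [PartialOrder B] [StarOrderedRing B] {ι : B →⋆ₐ[ℂ] A} (E : CondExp ι)

/-! ### Dense sets of vectors in the induced Hilbert space -/

section Density

variable {C : Type u} [NonUnitalCStarAlgebra C] (σ : CommPair A C)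

theorem continuous_inducedTmul_left (X : Corr.{u, u, u} A A) (h : σ.H) :
    Continuous fun x => inducedTmul X σ x h :=
  AddMonoidHomClass.continuous_of_bound ((inducedTmul X σ).flip h) ‖h‖ fun x =>
    (norm_inducedTmul_le X σ x h).trans_eq (mul_comm _ _)

theorem continuous_inducedTmul_right (X : Corr.{u, u, u} A A) (x : X.carrier) :
    Continuous fun h => inducedTmul X σ x h :=
  AddMonoidHomClass.continuous_of_bound (inducedTmul X σ x) ‖x‖ fun h =>
    norm_inducedTmul_le X σ x h

theorem CondExp.norm_tmul_le (v : E.L2.carrier) (y : A) : ‖E.tmul v y‖ ≤ ‖y‖ * ‖v‖ := by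
  rw [HilbertModule.norm_eq, E.ip_tmul, Real.sqrt_le_left (by positivity)]
  calc ‖star y * (ι (E.L2.ip v v) * y)‖ ≤ ‖star y‖ * (‖ι (E.L2.ip v v)‖ * ‖y‖) :=
        (norm_mul_le _ _).trans (by gcongr; exact norm_mul_le _ _)
    _ ≤ ‖y‖ * (‖E.L2.ip v v‖ * ‖y‖) := by
        rw [norm_star]
        gcongr
        exact NonUnitalStarAlgHom.norm_apply_le _ _
    _ = (‖y‖ * ‖v‖) ^ 2 := by
        rw [E.L2.norm_eq, mul_pow, Real.sq_sqrt (norm_nonneg _)]; ring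

theorem CondExp.tmul_smul (r : ℂ) (v : E.L2.carrier) (y : A) :
    E.tmul (r • v) y = r • E.tmul v y :=
  map_smul ((E.L2.tensorSemi (algCorr ι)).incl ∘ₗ
    (TensorProduct.mk ℂ E.L2.carrier (algCorr ι).carrier).flip y) r v

theorem CondExp.continuous_tmul (y : A) : Continuous fun v => E.tmul v y :=
  AddMonoidHomClass.continuous_of_bound
    ((E.L2.tensorSemi (algCorr ι)).incl ∘ₗ
      (TensorProduct.mk ℂ E.L2.carrier (algCorr ι).carrier).flip y) ‖y‖ fun v => E.norm_tmul_le v y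

theorem CondExp.mem_of_tmul_mem (W : Submodule ℂ (E.L2.tensor (algCorr ι)).carrier)
    (hW : IsClosed (W : Set (E.L2.tensor (algCorr ι)).carrier))
    (h : ∀ x y : A, E.tmul (E.toL2 x) y ∈ W) (v : (E.L2.tensor (algCorr ι)).carrier) : v ∈ W := by
  have h1 : ∀ (w : E.L2.carrier) (y : A), E.tmul w y ∈ W := fun w y =>
    E.denseRange_toL2.induction_on (p := fun w => E.tmul w y ∈ W) w
      (hW.preimage (E.continuous_tmul y)) fun x => h x y
  refine (E.L2.tensorSemi (algCorr ι)).denseRange_incl.induction_on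
    (p := fun v : (E.L2.tensor (algCorr ι)).carrier => v ∈ W) v hW fun t => ?_
  induction t using TensorProduct.induction_on with
  | zero => exact (map_zero (E.L2.tensorSemi (algCorr ι)).incl).symm ▸ W.zero_mem
  | tmul w y => exact h1 w y
  | add s t hs ht =>
    rw [map_add]
    exact W.add_mem hs ht

/-- Cyclicity of `Ω` lets every `h` be absorbed into `X` through `ξ ⊗ aΩ = ξa ⊗ Ω`. The vectors `ξ ⊗
Ω` with `ξ = ∑ xᵢ ⊗ yᵢ` form a subspace, so single vectors of this kind suffice, without sums over
several `ξ`. -/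
theorem CondExp.dense_vec_tmul {Ω : σ.H} (hΩ : DenseRange fun a => σ.σA a Ω) :
    Dense {v | ∃ (n : ℕ) (x y : Fin n → A),
      v = inducedTmul (E.L2.tensor (algCorr ι)) σ (E.vec x y) Ω} := by
  set X := E.L2.tensor (algCorr ι) with hX
  let P : Submodule ℂ (inducedPair X σ).H :=
    { carrier := {v | ∃ (n : ℕ) (x y : Fin n → A), v = inducedTmul X σ (E.vec x y) Ω}
      zero_mem' := ⟨0, Fin.elim0, Fin.elim0, by simp [CondExp.vec]⟩
      add_mem' := by
        rintro _ _ ⟨n, x, y, rfl⟩ ⟨n', x', y', rfl⟩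
        refine ⟨n + n', Fin.append x x', Fin.append y y', ?_⟩
        rw [← LinearMap.add_apply, ← map_add]
        simp [CondExp.vec, Fin.sum_univ_add]
      smul_mem' := by
        rintro r _ ⟨n, x, y, rfl⟩
        refine ⟨n, fun i => r • x i, y, ?_⟩
        rw [← LinearMap.smul_apply, ← map_smul]
        simp [CondExp.vec, Finset.smul_sum, E.tmul_smul] }
  have hP : IsClosed (P.topologicalClosure : Set (inducedPair X σ).H) :=
    P.isClosed_topologicalClosure
  have h1 : ∀ x : X.carrier, inducedTmul X σ x Ω ∈ P.topologicalClosure :=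
    E.mem_of_tmul_mem (P.topologicalClosure.comap ((inducedTmul X σ).flip Ω))
      (hP.preimage (continuous_inducedTmul_left σ X Ω))
      fun x y => P.le_topologicalClosure ⟨1, fun _ => x, fun _ => y, by simp [CondExp.vec]⟩
  have h2 : ∀ (x : X.carrier) (h : σ.H), inducedTmul X σ x h ∈ P.topologicalClosure :=
    fun x h => hΩ.induction_on (p := fun h => inducedTmul X σ x h ∈ P.topologicalClosure) h
      (hP.preimage (continuous_inducedTmul_right σ X x)) fun a => by
        rw [← inducedTmul_smul]
        exact h1 _
  have h3 : ∀ v : (inducedPair X σ).H, v ∈ P.topologicalClosure := fun v => by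
    refine (X.tensorSemi (Corr.ofRep σ.σA)).denseRange_incl.induction_on
      (p := fun v : (inducedPair X σ).H => v ∈ P.topologicalClosure) v hP fun t => ?_
    induction t using TensorProduct.induction_on with
    | zero => rw [map_zero]; exact P.topologicalClosure.zero_mem
    | tmul x h => exact h2 x h
    | add s t hs ht => rw [map_add]; exact P.topologicalClosure.add_mem hs ht
  exact fun v => h3 v

end Density

/-- The commutant of a representation. -/
noncomputable abbrev commutant {H : Type u} [NormedAddCommGroup H] [InnerProductSpace ℂ H]
    [CompleteSpace H] (π : A →⋆ₙₐ[ℂ] (H →L[ℂ] H)) : StarSubalgebra ℂ (H →L[ℂ] H) :=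
  StarSubalgebra.centralizer ℂ (Set.range π)

instance isClosed_commutant {H : Type u} [NormedAddCommGroup H] [InnerProductSpace ℂ H]
    [CompleteSpace H] (π : A →⋆ₙₐ[ℂ] (H →L[ℂ] H)) :
    IsClosed (commutant π : Set (H →L[ℂ] H)) := by
  rw [commutant, StarSubalgebra.coe_centralizer]
  exact Set.isClosed_centralizer _

/-- A representation paired with its commutant. -/
noncomputable def commutantPair {H : Type u} [NormedAddCommGroup H] [InnerProductSpace ℂ H]
    [CompleteSpace H] (π : A →⋆ₙₐ[ℂ] (H →L[ℂ] H)) : CommPair A (commutant π) where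
  H := H
  σA := π
  σC := ((commutant π).subtype : commutant π →⋆ₙₐ[ℂ] (H →L[ℂ] H))
  commute a c := (StarSubalgebra.mem_centralizer_iff ℂ |>.1 c.2 _ ⟨a, rfl⟩).1

theorem CommPair.re_inner_nonpos {C : Type u} [NonUnitalCStarAlgebra C] {p q : CommPair A C}
    (hpq : WeaklyContained p.rep q.rep) {z : MaxTensor A C} (hz : IsSelfAdjoint z)
    (hq : ∀ v, (inner ℂ v (q.rep z v)).re ≤ 0) (h : p.H) : (inner ℂ h (p.rep z h)).re ≤ 0 :=
  re_inner_nonpos_of_weaklyContained_subalgebra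
    (hS := NonUnitalStarSubalgebra.isClosed_topologicalClosure _) hpq hz hq h

theorem exists_isSelfAdjoint_rep_eq_sum {C : Type u} [NonUnitalCStarAlgebra C]
    {I : Type*} [Fintype I] {a : I → A} {c : I → C} (ha : ∀ i, IsSelfAdjoint (a i))
    (hc : ∀ i, IsSelfAdjoint (c i)) : ∃ z : MaxTensor A C, IsSelfAdjoint z ∧
      ∀ p : CommPair A C, p.rep z = ∑ i, p.σA (a i) * p.σC (c i) := by
  refine ⟨∑ i, ⟨pureTensor (a i) (c i), pureTensor_mem _ _⟩, ?_, fun p => map_sum _ _ _⟩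
  refine isSelfAdjoint_sum _ fun i _ => Subtype.ext ?_
  refine (star_pureTensor (a i) (c i)).trans ?_
  rw [(ha i).star_eq, (hc i).star_eq]

/-- The hypothesis on the cone says exactly that the induced image of `z = ∑ aᵢ ⊗ cᵢ` has
nonpositive form on a dense set. Nuclearity transports this to `σ`, where it is read at `Ω`. -/
theorem CondExp.sum_re_inner_nonpos (hE : E.IsNuclear) {C : Type u} [NonUnitalCStarAlgebra C]
    {σ : CommPair A C} (hσ : σ.Nondegenerate) {Ω : σ.H} (hΩ : DenseRange fun a => σ.σA a Ω)
    {I : Type*} [Fintype I] {a : I → A} {c : I → C} (ha : ∀ i, IsSelfAdjoint (a i))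
    (hc : ∀ i, IsSelfAdjoint (c i))
    (hneg : ∀ θ ∈ E.factorCone, ∑ i, (inner ℂ Ω ((σ.σA (θ (a i)) * σ.σC (c i)) Ω)).re ≤ 0) :
    ∑ i, (inner ℂ Ω ((σ.σA (a i) * σ.σC (c i)) Ω)).re ≤ 0 := by
  obtain ⟨z, hzs, hz⟩ := exists_isSelfAdjoint_rep_eq_sum ha hc
  set q := inducedPair (E.L2.tensor (algCorr ι)) σ with hq
  have hcl : IsClosed {v : q.H | (inner ℂ v (q.rep z v)).re ≤ 0} :=
    isClosed_le (by fun_prop) continuous_const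
  have key : ∀ v : q.H, (inner ℂ v (q.rep z v)).re ≤ 0 := by
    refine fun v => hcl.closure_subset_iff.2 ?_ (E.dense_vec_tmul σ hΩ v)
    rintro _ ⟨n, x, y, rfl⟩
    -- A single pair `φ`, `ψ` (`m = 1`) corresponds to the single vector `ξ ⊗ Ω`.
    have h1 := hneg _ ⟨n, 1, fun _ => x, fun _ => y, rfl⟩
    simp only [← sum_inner_inducedTmul, Fin.sum_univ_one] at h1
    rw [Set.mem_ofPred_eq, hz, _root_.sum_apply, inner_sum, Complex.re_sum]
    exact h1
  have h := CommPair.re_inner_nonpos (hE C σ hσ) hzs key Ω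
  rwa [hz, _root_.sum_apply, inner_sum, Complex.re_sum] at h

theorem commutantPair_nondegenerate {H : Type u} [NormedAddCommGroup H] [InnerProductSpace ℂ H]
    [CompleteSpace H] (π : A →⋆ₙₐ[ℂ] (H →L[ℂ] H)) (hπ : π 1 = 1) :
    (commutantPair π).Nondegenerate := by
  -- The element `1 ⊗ 1` acts as the identity.
  refine dense_univ.mono fun k _ => Submodule.subset_span
    ⟨⟨pureTensor 1 1, pureTensor_mem _ _⟩, k, ?_⟩
  change k = (π 1 * 1) k
  rw [hπ]
  rfl

theorem denseRange_gns (ω : A →ₚ[ℂ] ℂ) :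
    DenseRange fun a => ω.gnsNonUnitalStarAlgHom a (ω.toPreGNS 1 : ω.GNS) := by
  have h : (fun a => ω.gnsNonUnitalStarAlgHom a (ω.toPreGNS 1 : ω.GNS))
      = fun a => ((ω.toPreGNS a : ω.PreGNS) : ω.GNS) := by
    ext a
    simp
  rw [h]
  exact UniformSpace.Completion.denseRange_coe (α := ω.PreGNS)

/-- The commutant of the GNS representation of `∑ fᵢ` plays the role of `C`. It contains the
derivatives of all the `fᵢ` at once, so one pair of representations contradicts the separation. -/
theorem CondExp.exists_mem_nearDissipative (hE : E.IsNuclear) {I : Type*} [Fintype I]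
    {a : I → A} (ha : ∀ i, IsSelfAdjoint (a i)) {ε : ℝ} (hε : 0 < ε) :
    ∃ θ ∈ E.factorCone, ∀ i, a i - θ (a i) ∈ nearDissipative A ε := by
  by_contra hno
  obtain ⟨f, hpos, hnonpos⟩ := exists_positive_functionals a hε E.zero_mem_factorCone
    (fun θ hθ θ' hθ' => E.add_mem_factorCone hθ hθ')
    (fun θ hθ t ht => E.smul_mem_factorCone hθ ht) hno
  let ω : A →ₚ[ℂ] ℂ := PositiveLinearMap.mk₀ (∑ i, (f i).toLinearMap) fun p hp => by
    rw [LinearMap.sum_apply]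
    exact Finset.sum_nonneg fun i _ => (f i).map_nonneg hp
  have hω : ∀ p, ω p = ∑ i, f i p := fun p => LinearMap.sum_apply _ _ _
  have hle : ∀ i p, 0 ≤ p → f i p ≤ ω p := fun i p hp => by
    rw [hω]
    exact Finset.single_le_sum (f := fun i => f i p) (fun j _ => (f j).map_nonneg hp)
      (Finset.mem_univ i)
  choose T hTs hTc hT using fun i => exists_gns_derivative (hle i)
  let c : I → commutant ω.gnsNonUnitalStarAlgHom := fun i => ⟨T i, by
    rw [StarSubalgebra.mem_centralizer_iff]
    rintro _ ⟨a, rfl⟩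
    refine ⟨hTc i a, ?_⟩
    rw [← StarHomClass.map_star]
    exact hTc i _⟩
  have hin : ∀ i b, inner ℂ (ω.toPreGNS 1 : ω.GNS)
      ((ω.gnsNonUnitalStarAlgHom b * T i) (ω.toPreGNS 1 : ω.GNS)) = f i b := by
    intro i b
    rw [hTc, mul_apply_eq_comp, ω.gnsNonUnitalStarAlgHom_apply_coe]
    refine (hT i 1 (b * 1)).trans ?_
    rw [star_one, one_mul, mul_one]
  have hin' : ∀ i b, inner ℂ (ω.toPreGNS 1 : ω.GNS)
      (((commutantPair ω.gnsNonUnitalStarAlgHom).σA b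
        * (commutantPair ω.gnsNonUnitalStarAlgHom).σC (c i)) (ω.toPreGNS 1 : ω.GNS)) = f i b := hin
  have h1 := E.sum_re_inner_nonpos hE
    (commutantPair_nondegenerate ω.gnsNonUnitalStarAlgHom (map_one ω.gnsStarAlgHom))
    (denseRange_gns ω) ha (c := c) (fun i => Subtype.ext (hTs i)) fun θ hθ =>
      le_of_eq_of_le (Finset.sum_congr rfl fun i _ => congrArg Complex.re (hin' i _))
        (hnonpos θ hθ)
  exact absurd (le_of_eq_of_le (Finset.sum_congr rfl fun i _ =>
    congrArg Complex.re (hin' i _).symm) h1) (not_le.2 hpos)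

theorem CondExp.map_star_of_mem_factorCone {θ : A →ₗ[ℂ] A} (hθ : θ ∈ E.factorCone) (a : A) :
    θ (star a) = star (θ a) := by
  obtain ⟨n, m, x, y, rfl⟩ := hθ
  simp only [factorMap_apply, star_sum]
  refine Finset.sum_congr rfl fun k _ => ?_
  rw [Finset.sum_comm]
  refine Finset.sum_congr rfl fun i _ => Finset.sum_congr rfl fun j _ => ?_
  simp only [star_mul, ← StarHomClass.map_star, ← CondExp.map_star, star_star, mul_assoc]

theorem CondExp.approx_of_isNuclear (hE : E.IsNuclear) (F : Finset A) {ε : ℝ} (hε : 0 < ε) :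
    ∃ θ ∈ E.factorCone, ∀ a ∈ F, ‖a - θ a‖ < ε := by
  -- One `θ` must serve for the real and imaginary parts of every element of `F` with both signs.
  -- The signs turn the one-sided estimate into a norm estimate; the two parts then contribute at
  -- most `ε / 3` each.
  let d : F × Bool → selfAdjoint A := fun p => if p.2 then realPart p.1.1 else imaginaryPart p.1.1
  let e : (F × Bool) × Bool → selfAdjoint A := fun p => if p.2 then d p.1 else - d p.1
  obtain ⟨θ, hθ, h⟩ := E.exists_mem_nearDissipative hE (a := fun p => (e p : A))
    (fun p => (e p).2) (show 0 < ε / 3 by positivity)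
  have hd : ∀ p, ‖(d p : A) - θ (d p)‖ ≤ ε / 3 := by
    intro p
    refine norm_le_of_mem_nearDissipative ?_ ?_ ?_
    -- Maps in the cone preserve adjoints, so the error at a self-adjoint element is self-adjoint,
    -- as the one-sided bound requires.
    · rw [IsSelfAdjoint, star_sub, ← E.map_star_of_mem_factorCone hθ, (d p).2.star_eq]
    · simpa [e] using h (p, true)
    · have := h (p, false)
      simp only [e, Bool.false_eq_true, if_false, NegMemClass.coe_neg, map_neg] at this
      rwa [neg_sub, ← neg_sub_neg]
  refine ⟨θ, hθ, fun a ha => ?_⟩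
  have h1 : ‖(realPart a : A) - θ (realPart a)‖ ≤ ε / 3 := hd (⟨a, ha⟩, true)
  have h2 : ‖(imaginaryPart a : A) - θ (imaginaryPart a)‖ ≤ ε / 3 := hd (⟨a, ha⟩, false)
  have h3 : a - θ a = ((realPart a : A) - θ (realPart a))
      + Complex.I • ((imaginaryPart a : A) - θ (imaginaryPart a)) := by
    nth_rewrite 1 2 [← realPart_add_I_smul_imaginaryPart a]
    rw [map_add, map_smul, smul_sub]
    abel
  rw [h3]
  refine (norm_add_le _ _).trans_lt ?_
  rw [norm_smul, Complex.norm_I, one_mul]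
  linarith

end Necessity

end RelNuc


theorem theoremA {A B : Type u} [CStarAlgebra A] [PartialOrder A] [StarOrderedRing A]
    [CStarAlgebra B] [PartialOrder B] [StarOrderedRing B]
    (ι : B →⋆ₐ[ℂ] A) (E : RelNuc.CondExp ι) :
    E.IsNuclear ↔
      ∀ (F : Finset A) (ε : ℝ), 0 < ε →
        ∃ (n m : ℕ) (φ : Fin m → (A →CP CStarMatrix (Fin n) (Fin n) B))
          (ψ : Fin m → (CStarMatrix (Fin n) (Fin n) B →CP A)),
          (∀ a ∈ F, ‖a - ∑ k, ψ k (φ k a)‖ < ε) ∧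
          ∀ k, ∃ x y : Fin n → A,
            (∀ a, φ k a =
              CStarMatrix.ofMatrix fun i j => E.toLinearMap (star (x i) * a * x j)) ∧
            (∀ b, ψ k b = ∑ i, ∑ j, star (y i) * ι (b i j) * y j) := by
  constructor
  · intro hE F ε hε
    obtain ⟨_, ⟨n, m, x, y, rfl⟩, hθ⟩ := E.approx_of_isNuclear hE F hε
    exact ⟨n, m, fun k => E.compress (x k), fun k => RelNuc.rowConj ι (y k),
      fun a ha => by rw [← E.factorMap_eq]; exact hθ a ha,
      fun k => ⟨x k, y k, fun _ => rfl, fun _ => rfl⟩⟩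
  · intro h
    refine E.isNuclear_of_approx fun F ε hε => ?_
    obtain ⟨n, m, φ, ψ, hF, hk⟩ := h F ε hε
    choose x y hφ hψ using hk
    refine ⟨_, ⟨n, m, x, y, rfl⟩, fun a ha => ?_⟩
    convert hF a ha using 3
    rw [E.factorMap_apply]
    refine Finset.sum_congr rfl fun k _ => ?_
    rw [hψ, hφ]
    rfl
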